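/- Let $K$ be a function field, that is, a field that is finitely generated and transcendental over some subfield $k$, and let $p \ge 0$ be the characteristic of $K$. Let $d \ge 2$ be an integer, and suppose that $p = 0$ or $p > d$. Let $\overline{K}$ be an algebraic closure of $K$, and let $\varphi(z) \in K(z)$ be a rational function of degree $d$ that is post-critically finite (PCF): every critical point of $\varphi$ in $\mathbb{P}^1(\overline{K})$ has a finite forward orbit under iteration of $\varphi$. Let $\gamma \in \mathbb{P}^1(\overline{K})$ be a periodic point of $\varphi$, of minimal period $n \ge 1$, and let $\lambda = (\varphi^n)'(\gamma) \in \overline{K}$ be its multiplier, where $\varphi^n$ is the $n$-th iterate and the derivative is computed in any coordinate in which $\gamma \neq \infty$. Then $\lambda$ is algebraic over the prime subfield of $K$. -/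

import Mathlib

noncomputable section

namespace RatDyn

/-- A field `K` is a function field (in one or more variables) if it is finitely generated and
transcendental over some subfield `k` of constants. The constant field may be any field. -/
def IsFunctionField (K : Type*) [Field K] : Prop :=
  ∃ k : Subfield K, (⊤ : IntermediateField k K).FG ∧ Algebra.Transcendental k K

variable {L : Type*} [Field L]

/-- The degree of a rational function, in lowest terms. -/
def degree (φ : RatFunc L) : ℕ := max φ.num.natDegree φ.denom.natDegree

/-- The composite `φ(ψ(z))`. It is meant for nonconstant `ψ`, so that the denominator of `φ`
does not vanish at `ψ`. -/
def comp (φ ψ : RatFunc L) : RatFunc L := φ.eval (algebraMap L (RatFunc L)) ψ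

/-- The `n`-fold composite of `φ` with itself, as a rational function. -/
def iter (φ : RatFunc L) : ℕ → RatFunc L
  | 0 => RatFunc.X
  | n + 1 => comp φ (iter φ n)

/-- The formal derivative of `φ` evaluated at a point `a` that is not a pole of `φ`. -/
def derivAt (φ : RatFunc L) (a : L) : L :=
  (φ.num.derivative.eval a * φ.denom.eval a - φ.num.eval a * φ.denom.derivative.eval a) /
    φ.denom.eval a ^ 2

/-! The projective line over `L` is `OnePoint L`. We use the coordinate `z` at finite points and
the coordinate `1/z` at infinity. -/

/-- The coordinate of a point: `z` at a finite point, and `1/z`, which is `0`, at infinity. -/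
def coord : OnePoint L → L
  | OnePoint.infty => 0
  | OnePoint.some a => a

/-- `φ` written in the coordinate of the source that is used at the point `x`. -/
def pull (φ : RatFunc L) : OnePoint L → RatFunc L
  | OnePoint.infty => comp φ (RatFunc.X)⁻¹
  | OnePoint.some _ => φ

open Classical in
/-- The self-map of the projective line that is defined by `φ`. -/
def onP1 (φ : RatFunc L) (x : OnePoint L) : OnePoint L :=
  if (pull φ x).denom.eval (coord x) = 0 then OnePoint.infty
  else OnePoint.some ((pull φ x).num.eval (coord x) / (pull φ x).denom.eval (coord x))

open Classical in
/-- The derivative of `φ` at a point `x` of the projective line, with respect to the coordinates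
used at `x` and at `φ(x)`. -/
def localDeriv (φ : RatFunc L) (x : OnePoint L) : L :=
  if (pull φ x).denom.eval (coord x) = 0 then derivAt (pull φ x)⁻¹ (coord x)
  else derivAt (pull φ x) (coord x)

/-- Critical points: the derivative in local coordinates vanishes. -/
def IsCritical (φ : RatFunc L) (x : OnePoint L) : Prop := localDeriv φ x = 0

/-- Every critical point in the projective line over `L` has a finite forward orbit. This is
post-critical finiteness when `L` is algebraically closed. -/
def IsPCF (φ : RatFunc L) : Prop :=
  ∀ x : OnePoint L, IsCritical φ x → (Set.range fun n : ℕ => (onP1 φ)^[n] x).Finite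

/-- The multiplier of a periodic point `γ` of minimal period `n`: the derivative at `γ` of the
`n`-th iterate, in one coordinate at `γ`, used at source and target. -/
def multiplier (φ : RatFunc L) (γ : OnePoint L) : L :=
  localDeriv (iter φ (Function.minimalPeriod (onP1 φ) γ)) γ

/-- The rational function `φ` viewed over the algebraic closure of its field of coefficients. -/
def toClosure {K : Type*} [Field K] (φ : RatFunc K) : RatFunc (AlgebraicClosure K) :=
  RatFunc.map (Polynomial.mapRingHom (algebraMap K (AlgebraicClosure K)))
    (nonZeroDivisors_le_comap_nonZeroDivisors_of_injective _
      (Polynomial.map_injective _ (algebraMap K (AlgebraicClosure K)).injective)) φ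

end RatDyn

end

/-! Suppose that the multiplier λ is transcendental over the prime field. Then there is a valuation,
trivial on the prime field, with |λ| < 1 and such that every element is bounded by a power of 1/λ
(`exists_valuationSubring`). The cycle becomes attracting, but it contains no critical point because
λ ≠ 0. As over the complex numbers, such a cycle should attract a critical point with infinite
orbit; the hypothesis on p makes the nonzero integers up to d units, which excludes the pathologies
of wild ramification.

The contradiction comes from pulling back discs. The postcritical set E is finite, so small discs
about the points of the cycle meet E at most in their centres. Over such a disc about f(a), the
pulled-back disc about a, with radius divided by |f'(a)|, contains no pole and no second preimage of
the centre, and |f(x) - f(a)| = |f'(a)| |x - a| on it. As E is forward invariant, the new disc also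
meets E at most in its centre (`CycleData.pullback`). After k turns the radius has been multiplied
by |λ|^(-k), so the discs exhaust the affine line. Hence f has no finite pole and takes the value γ
1 only at γ 0, simply, and its degree is at most 1 (`CycleData.false_of_attracting`).

The nonarchimedean core is `isolated_zero`. Give each zero or pole α of f its order n α as a charge,
so that f'/f = ∑ n α / (z - α). A closed disc of nonzero charge contains exactly one zero of f'/f
fewer than charged points (`card_roots_logNum`). Zeros of f'/f are critical points with nonzero
value, so there |f| > r by hypothesis, whereas |f| has its generic value on a disc away from the
charged residue classes. If that generic value is at most r and at least two classes are charged,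
all zeros lie in charged classes, at least two are missing, and the charge of the disc must vanish
(`ChargeData.neutral`). The generic value stays constant while a neutral disc grows to the next
charge. So a second charge too close to a simple zero would make all larger discs neutral, up to one
that contains every charge, whose generic value |f(∞)| exceeds r.

Conjugation by a + 1/z makes infinity a critical point. This keeps the cycle in the affine line and
puts the image of infinity in the postcritical set. -/

namespace RatDyn

open Polynomial

/-! ### Counting zeros of a logarithmic derivative in a disc -/

section Dominance

section

variable {Γ : Type*} [LinearOrderedCommGroupWithZero Γ]

lemma mul_lt_one_of_lt_le {a b : Γ} (ha : a < 1) (hb : b ≤ 1) : a * b < 1 :=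
  mul_lt_one_of_nonneg_of_lt_one_left zero_le ha hb

lemma mul_lt_one_of_le_lt {a b : Γ} (ha : a ≤ 1) (hb : b < 1) : a * b < 1 := by
  rw [mul_comm]; exact mul_lt_one_of_lt_le hb ha

end

variable {L Γ : Type*} [Field L] [LinearOrderedCommGroupWithZero Γ] (v : Valuation L Γ)

/-- All coefficients of `F` are integral, the coefficient of degree `k` is congruent to `u` modulo
the maximal ideal, and all higher coefficients lie in the maximal ideal. -/
structure Dom (F : L[X]) (k : ℕ) (u : L) : Prop where
  int : ∀ i, v (F.coeff i) ≤ 1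
  lead : v (F.coeff k - u) < 1
  high : ∀ i, k < i → v (F.coeff i) < 1

variable {v}

lemma Dom.add {F G : L[X]} {k : ℕ} {u w : L} (hF : Dom v F k u) (hG : Dom v G k w) :
    Dom v (F + G) k (u + w) where
  int i := by
    rw [coeff_add]; exact (v.map_add _ _).trans (max_le (hF.int i) (hG.int i))
  lead := by
    have : (F + G).coeff k - (u + w) = (F.coeff k - u) + (G.coeff k - w) := by
      rw [coeff_add]; ring
    rw [this]; exact v.map_add_lt hF.lead hG.lead
  high i hi := by
    rw [coeff_add]; exact v.map_add_lt (hF.high i hi) (hG.high i hi)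

lemma Dom.zero (k : ℕ) : Dom v 0 k 0 where
  int i := by simp
  lead := by simp
  high i _ := by simp

lemma Dom.sum {ι : Type*} (I : Finset ι) (F : ι → L[X]) (u : ι → L) (k : ℕ)
    (h : ∀ i ∈ I, Dom v (F i) k (u i)) : Dom v (∑ i ∈ I, F i) k (∑ i ∈ I, u i) := by
  classical
  induction I using Finset.induction_on with
  | empty => simpa using Dom.zero k
  | insert a s ha ih =>
    rw [Finset.sum_insert ha, Finset.sum_insert ha]
    exact (h a (by simp)).add (ih fun i hi => h i (by simp [hi]))

/-- In degree `k + l` only the pair `(k, l)` survives modulo the maximal ideal: any other pair has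
an index above `k` or above `l`. -/
lemma Dom.mul {F G : L[X]} {k l : ℕ} {u w : L} (hu : v u ≤ 1) (hF : Dom v F k u)
    (hG : Dom v G l w) : Dom v (F * G) (k + l) (u * w) where
  int i := by
    rw [coeff_mul]
    refine v.map_sum_le fun x _ => ?_
    rw [map_mul]
    exact mul_le_one' (hF.int _) (hG.int _)
  lead := by
    have hmem : (k, l) ∈ Finset.HasAntidiagonal.antidiagonal (k + l) := by simp
    rw [coeff_mul, ← Finset.add_sum_erase _ _ hmem]
    have h1 : v (F.coeff k * G.coeff l - u * w) < 1 := by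
      have : F.coeff k * G.coeff l - u * w
          = (F.coeff k - u) * G.coeff l + u * (G.coeff l - w) := by ring
      rw [this]
      refine v.map_add_lt ?_ ?_
      · rw [map_mul]; exact mul_lt_one_of_lt_le hF.lead (hG.int _)
      · rw [map_mul]; exact mul_lt_one_of_le_lt hu hG.lead
    rw [add_sub_right_comm]
    refine v.map_add_lt h1 (v.map_sum_lt one_ne_zero fun x hx => ?_)
    obtain ⟨hx1, hx2⟩ := Finset.mem_erase.1 hx
    rw [Finset.HasAntidiagonal.mem_antidiagonal] at hx2
    rw [map_mul]
    rcases lt_trichotomy x.1 k with h | h | h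
    · exact mul_lt_one_of_le_lt (hF.int _) (hG.high _ (by omega))
    · exact absurd (Prod.ext h (by simp only; omega)) hx1
    · exact mul_lt_one_of_lt_le (hF.high _ h) (hG.int _)
  high i hi := by
    rw [coeff_mul]
    refine v.map_sum_lt one_ne_zero fun x hx => ?_
    rw [Finset.HasAntidiagonal.mem_antidiagonal] at hx
    rw [map_mul]
    rcases lt_or_ge k x.1 with h | h
    · exact mul_lt_one_of_lt_le (hF.high _ h) (hG.int _)
    · exact mul_lt_one_of_le_lt (hF.int _) (hG.high _ (by omega))

lemma Dom.const_mul {F : L[X]} {k : ℕ} {u c : L} (hc : v c ≤ 1) (hF : Dom v F k u) :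
    Dom v (C c * F) k (c * u) where
  int i := by rw [coeff_C_mul, map_mul]; exact mul_le_one' hc (hF.int _)
  lead := by
    rw [coeff_C_mul, ← mul_sub, map_mul]; exact mul_lt_one_of_le_lt hc hF.lead
  high i hi := by
    rw [coeff_C_mul, map_mul]; exact mul_lt_one_of_le_lt hc (hF.high i hi)

lemma Dom.const_mul_small {F : L[X]} {k : ℕ} {u c : L} (hc : v c < 1) (hF : Dom v F k u) (l : ℕ) :
    Dom v (C c * F) l 0 where
  int i := by rw [coeff_C_mul, map_mul]; exact mul_le_one' hc.le (hF.int _)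
  lead := by
    rw [coeff_C_mul, sub_zero, map_mul]; exact mul_lt_one_of_lt_le hc (hF.int _)
  high i _ := by
    rw [coeff_C_mul, map_mul]; exact mul_lt_one_of_lt_le hc (hF.int i)

lemma Dom.one : Dom v (1 : L[X]) 0 1 where
  int i := by rw [coeff_one]; split_ifs <;> simp
  lead := by simp
  high i hi := by rw [coeff_one, if_neg (by omega)]; simp

lemma Dom.X_sub_C {x : L} (hx : v x ≤ 1) : Dom v (X - C x) 1 1 where
  int i := by
    rw [coeff_sub, coeff_X, coeff_C]
    exact (v.map_sub _ _).trans (max_le (by split_ifs <;> simp) (by split_ifs <;> simp [hx]))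
  lead := by simp [coeff_X]
  high i hi := by rw [coeff_sub, coeff_X, coeff_C, if_neg (by omega), if_neg (by omega)]; simp

lemma Dom.one_sub {x : L} (hx : 1 < v x) : Dom v (1 - C x⁻¹ * X) 0 1 := by
  have hx' : v x⁻¹ < 1 := by rw [map_inv₀]; exact inv_lt_one_of_one_lt₀ hx
  refine ⟨fun i => ?_, ?_, fun i hi => ?_⟩
  · rw [coeff_sub, coeff_one, coeff_C_mul, coeff_X]
    refine (v.map_sub _ _).trans (max_le (by split_ifs <;> simp) ?_)
    split_ifs
    · rw [mul_one]; exact hx'.le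
    · simp
  · simp
  · rw [coeff_sub, coeff_one, coeff_C_mul, coeff_X, if_neg (by omega), zero_sub, Valuation.map_neg]
    split_ifs
    · rw [mul_one]; exact hx'
    · simp

open Classical in
variable (v) in
/-- The linear factor with root `x`, normalized to have integral coefficients. -/
noncomputable def factor (x : L) : L[X] := if v x ≤ 1 then X - C x else 1 - C x⁻¹ * X

open Classical in
variable (v) in
/-- The ratio between `X - x` and the normalized factor. -/
noncomputable def factorConst (x : L) : L := if v x ≤ 1 then 1 else -x

lemma factor_spec (x : L) : X - C x = C (factorConst v x) * factor v x := by
  unfold factor factorConst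
  split_ifs with h
  · simp
  · have hx : x ≠ 0 := by rintro rfl; simp at h
    rw [mul_sub, ← mul_assoc, ← C_mul, neg_mul, mul_inv_cancel₀ hx]
    simp only [map_neg, map_one]; ring

lemma factorConst_ne_zero (x : L) : factorConst v x ≠ 0 := by
  unfold factorConst
  split_ifs with h
  · exact one_ne_zero
  · rw [neg_ne_zero]; rintro rfl; simp at h

lemma dom_factor_le {x : L} (hx : v x ≤ 1) : Dom v (factor v x) 1 1 := by
  rw [factor, if_pos hx]; exact Dom.X_sub_C hx

lemma dom_factor_gt {x : L} (hx : ¬ v x ≤ 1) : Dom v (factor v x) 0 1 := by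
  rw [factor, if_neg hx]; exact Dom.one_sub (not_le.1 hx)

open Classical in
lemma dom_prod_factor {ι : Type*} (I : Finset ι) (α : ι → L) :
    Dom v (∏ i ∈ I, factor v (α i)) (I.filter fun i => v (α i) ≤ 1).card 1 := by
  induction I using Finset.induction_on with
  | empty => simpa using Dom.one
  | insert a s ha ih =>
    rw [Finset.prod_insert ha, Finset.filter_insert]
    by_cases h : v (α a) ≤ 1
    · rw [if_pos h, Finset.card_insert_of_notMem (by simp [ha]), add_comm]
      simpa using Dom.mul (by simp) (dom_factor_le h) ih
    · rw [if_neg h]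
      simpa using Dom.mul (by simp) (dom_factor_gt h) ih

open Classical in
lemma dom_multiset_prod (s : Multiset L) :
    ∃ c : L, ∃ G : L[X], (s.map fun x => X - C x).prod = C c * G ∧
      Dom v G (s.filter fun x => v x ≤ 1).card 1 := by
  induction s using Multiset.induction_on with
  | empty => exact ⟨1, 1, by simp, by simpa using Dom.one⟩
  | cons a s ih =>
    obtain ⟨c, G, h1, h2⟩ := ih
    refine ⟨factorConst v a * c, factor v a * G, ?_, ?_⟩
    · rw [Multiset.map_cons, Multiset.prod_cons, h1, factor_spec (v := v) a, C_mul]; ring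
    · by_cases h : v a ≤ 1
      · rw [Multiset.filter_cons_of_pos (p := fun x => v x ≤ 1) _ h, Multiset.card_cons, add_comm]
        simpa using Dom.mul (by simp) (dom_factor_le h) h2
      · rw [Multiset.filter_cons_of_neg (p := fun x => v x ≤ 1) _ h]
        simpa using Dom.mul (by simp) (dom_factor_gt h) h2

lemma Dom.val_lead {F : L[X]} {k : ℕ} {u : L} (h : Dom v F k u) (hu : v u = 1) :
    v (F.coeff k) = 1 := by
  have := v.map_add_eq_of_lt_right (x := F.coeff k - u) (y := u) (by rw [hu]; exact h.lead)
  rwa [sub_add_cancel, hu] at this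

open Classical in
/-- The number of roots in the closed unit disc is the index of the last coefficient of maximal
absolute value. -/
lemma Dom.card_roots {c u : L} {s : Multiset L} {k : ℕ} (hu : v u = 1)
    (h : Dom v (C c * (s.map fun x => X - C x).prod) k u) :
    (s.filter fun x => v x ≤ 1).card = k := by
  obtain ⟨c', G, h1, h2⟩ := dom_multiset_prod (v := v) s
  rw [h1, ← mul_assoc, ← C_mul] at h
  set m := (s.filter fun x => v x ≤ 1).card
  have e1 := h.val_lead hu
  have e2 := h2.val_lead (by simp)
  rw [coeff_C_mul, map_mul] at e1
  have e3 := h.int m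
  rw [coeff_C_mul, map_mul, e2, mul_one] at e3
  rcases lt_trichotomy m k with hlt | heq | hlt
  · have := h2.high k hlt
    exact absurd e1 (mul_lt_one_of_le_lt e3 this).ne
  · exact heq
  · have := h.high m hlt
    rw [coeff_C_mul, map_mul, e2, mul_one] at this
    exact absurd e1 (mul_lt_one_of_lt_le this (h2.int k)).ne

/-- The numerator of the logarithmic derivative `∑ nᵢ / (X - αᵢ)`. -/
noncomputable def logNum {ι : Type*} [DecidableEq ι] (I : Finset ι) (α : ι → L) (n : ι → L) :
    L[X] :=
  ∑ i ∈ I, C (n i) * ∏ j ∈ I.erase i, (X - C (α j))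

open Classical in
-- After the linear factors are normalized, the term of a point in the unit disc reduces to degree
-- `D.card - 1` with leading coefficient `n i`. The term of a point outside carries a factor `(-α
-- i)⁻¹` and vanishes in the reduction. So the reduction has the total charge, a unit, as its
-- leading coefficient.
lemma card_roots_logNum_unit {ι : Type*} (I : Finset ι) (α n : ι → L)
    (hn : ∀ i ∈ I, v (n i) ≤ 1) (hD : v (∑ i ∈ I with v (α i) ≤ 1, n i) = 1)
    {c : L} {s : Multiset L} (hs : logNum I α n = C c * (s.map fun x => X - C x).prod) :
    (s.filter fun x => v x ≤ 1).card + 1 = (I.filter fun i => v (α i) ≤ 1).card := by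
  set D := I.filter fun i => v (α i) ≤ 1 with hDdef
  have hDne : D.Nonempty := by
    rw [Finset.nonempty_iff_ne_empty]
    intro h0
    rw [h0] at hD; simp at hD
  have hpos := hDne.card_pos
  set κ := ∏ j ∈ I, factorConst v (α j) with hκ
  have hκ0 : κ ≠ 0 := Finset.prod_ne_zero_iff.2 fun i _ => factorConst_ne_zero _
  have key : Dom v (C κ⁻¹ * logNum I α n) (D.card - 1) (∑ i ∈ D, n i) := by
    have e1 : C κ⁻¹ * logNum I α n
        = ∑ i ∈ I, C (n i * (factorConst v (α i))⁻¹) * ∏ j ∈ I.erase i, factor v (α j) := by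
      rw [logNum, Finset.mul_sum]
      refine Finset.sum_congr rfl fun i hi => ?_
      have e2 : ∏ j ∈ I.erase i, (X - C (α j))
          = C (∏ j ∈ I.erase i, factorConst v (α j)) * ∏ j ∈ I.erase i, factor v (α j) := by
        rw [map_prod, ← Finset.prod_mul_distrib]
        exact Finset.prod_congr rfl fun j _ => factor_spec _
      rw [e2, ← mul_assoc, ← mul_assoc, ← C_mul, ← C_mul]
      congr 2
      have e3 : factorConst v (α i) * ∏ j ∈ I.erase i, factorConst v (α j) = κ :=
        Finset.mul_prod_erase I (fun j => factorConst v (α j)) hi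
      have h1 : factorConst v (α i) ≠ 0 := factorConst_ne_zero _
      field_simp
      rw [← e3]; ring
    rw [e1, hDdef, Finset.sum_filter]
    refine Dom.sum _ _ _ _ fun i hi => ?_
    have hp := dom_prod_factor (v := v) (I.erase i) α
    split_ifs with h
    · have e4 : ((I.erase i).filter fun i => v (α i) ≤ 1).card = D.card - 1 := by
        rw [Finset.filter_erase, Finset.card_erase_of_mem]
        simp [hi, h]
      rw [e4] at hp
      have : factorConst v (α i) = 1 := by rw [factorConst, if_pos h]
      rw [this, inv_one, mul_one]
      simpa using hp.const_mul (hn i hi)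
    · refine hp.const_mul_small ?_ _
      rw [factorConst, if_neg h, map_mul, map_inv₀, Valuation.map_neg]
      exact mul_lt_one_of_le_lt (hn i hi) (inv_lt_one_of_one_lt₀ (not_le.1 h))
  rw [hs, ← mul_assoc, ← C_mul] at key
  have := key.card_roots hD
  omega

open Classical in
/-- A closed disc whose total charge is a unit contains exactly one zero of the logarithmic
derivative less than it contains poles. -/
lemma card_roots_logNum {ι : Type*} (I : Finset ι) (α n : ι → L) (a t : L) (ht : t ≠ 0)
    (hn : ∀ i ∈ I, v (n i) ≤ 1) (hD : v (∑ i ∈ I with v (α i - a) ≤ v t, n i) = 1)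
    {c : L} {s : Multiset L} (hs : logNum I α n = C c * (s.map fun x => X - C x).prod) :
    (s.filter fun x => v (x - a) ≤ v t).card + 1
      = (I.filter fun i => v (α i - a) ≤ v t).card := by
  have hvt : v t ≠ 0 := (Valuation.ne_zero_iff _).2 ht
  -- The substitution `t * X + a` carries the unit disc to the given disc.
  have hiff : ∀ x, v ((x - a) / t) ≤ 1 ↔ v (x - a) ≤ v t := fun x => by
    rw [map_div₀, div_le_one₀ (zero_lt_iff.2 hvt)]
  have hlin : ∀ x, (X - C x : L[X]).comp (C t * X + C a) = C t * (X - C ((x - a) / t)) := by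
    intro x
    rw [mul_sub, ← C_mul, mul_div_cancel₀ _ ht]
    simp only [sub_comp, X_comp, C_comp, map_sub]; ring
  have e1 : (logNum I α n).comp (C t * X + C a)
      = C (t ^ (I.card - 1)) * logNum I (fun i => (α i - a) / t) n := by
    rw [logNum, logNum, sum_comp, Finset.mul_sum]
    refine Finset.sum_congr rfl fun i hi => ?_
    rw [mul_comp, C_comp, prod_comp, Finset.prod_congr rfl fun j _ => hlin (α j),
      Finset.prod_mul_distrib, Finset.prod_const, Finset.card_erase_of_mem hi, C_pow]
    ring
  have e2 : logNum I (fun i => (α i - a) / t) n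
      = C ((t ^ (I.card - 1))⁻¹ * c * t ^ s.card) *
        ((s.map fun x => (x - a) / t).map fun x => X - C x).prod := by
    have h1 : logNum I (fun i => (α i - a) / t) n
        = C ((t ^ (I.card - 1))⁻¹) * (logNum I α n).comp (C t * X + C a) := by
      rw [e1, ← mul_assoc, ← C_mul, inv_mul_cancel₀ (pow_ne_zero _ ht), C_1, one_mul]
    rw [h1, hs, mul_comp, C_comp, multiset_prod_comp, Multiset.map_map, Multiset.map_map,
      C_mul, C_mul, mul_assoc, mul_assoc]
    congr 2
    have : (s.map ((fun p : L[X] => p.comp (C t * X + C a)) ∘ fun x => X - C x))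
        = s.map fun x => C t * (X - C ((x - a) / t)) := Multiset.map_congr rfl fun x _ => hlin x
    rw [this, Multiset.prod_map_mul, Multiset.map_const', Multiset.prod_replicate, C_pow]
    rfl
  have := card_roots_logNum_unit (v := v) I (fun i => (α i - a) / t) n hn
    (by simpa only [hiff] using hD) e2
  rw [Multiset.filter_map, Multiset.card_map] at this
  simpa only [Function.comp_def, hiff] using this

end Dominance

end RatDyn

namespace RatDyn

open Polynomial

/-! ### Discs of total charge zero -/

section Charges

variable {L Γ : Type*} [Field L] [LinearOrderedCommGroupWithZero Γ] (v : Valuation L Γ)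

open Classical in
-- Each class met by `D` has at least one element of `W` fewer than of `D`; the deficits add up over
-- the classes. The classes will be the open residue discs of a closed disc.
lemma card_add_card_image_le {α β : Type*} (cl : α → β) (D : Finset α) (W : Multiset α)
    (h1 : ∀ z ∈ W, ∃ a ∈ D, cl a = cl z)
    (h2 : ∀ b ∈ D, (W.filter fun z => cl z = cl b).card + 1
      ≤ (D.filter fun z => cl z = cl b).card) :
    W.card + (D.image cl).card ≤ D.card := by
  have e1 : ∑ q ∈ D.image cl, (W.map cl).count q = W.card := by
    rw [Multiset.sum_count_eq_card, Multiset.card_map]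
    intro q hq
    obtain ⟨z, hz, rfl⟩ := Multiset.mem_map.1 hq
    obtain ⟨a, ha, hza⟩ := h1 z hz
    exact Finset.mem_image.2 ⟨a, ha, hza⟩
  rw [← e1, Finset.card_eq_sum_ones, ← Finset.sum_add_distrib,
    Finset.card_eq_sum_card_image cl D]
  refine Finset.sum_le_sum fun q hq => ?_
  obtain ⟨b, hb, rfl⟩ := Finset.mem_image.1 hq
  have := h2 b hb
  rw [Multiset.count_map]
  simpa only [eq_comm] using this

lemma prod_zpow_const {ι G : Type*} [CommGroupWithZero G] (B : Finset ι) (n : ι → ℤ) {τ : G}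
    (hτ : τ ≠ 0) : ∏ i ∈ B, τ ^ n i = τ ^ ∑ i ∈ B, n i := by
  classical
  induction B using Finset.induction_on with
  | empty => simp
  | insert a s ha ih => rw [Finset.prod_insert ha, Finset.sum_insert ha, zpow_add₀ hτ, ih]

open Classical in
-- Charges of sum zero, all seen from the same distance `τ`, contribute `τ ^ 0 = 1`. This is why
-- generic values do not change across a neutral disc.
lemma prod_zpow_of_neutral {ι G : Type*} [CommGroupWithZero G] {S B : Finset ι} (hBS : B ⊆ S)
    (n : ι → ℤ) (hB : ∑ i ∈ B, n i = 0) {g : ι → G} (h : ι → G) {τ : G} (hτ : τ ≠ 0)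
    (h1 : ∀ i ∈ B, g i = τ) (h2 : ∀ i ∈ S, i ∉ B → g i = h i) :
    ∏ i ∈ S, g i ^ n i = ∏ i ∈ S \ B, h i ^ n i := by
  rw [← Finset.prod_sdiff hBS, Finset.prod_congr (s₁ := B) rfl fun i hi => by rw [h1 i hi],
    prod_zpow_const B n hτ, hB, zpow_zero, mul_one]
  refine Finset.prod_congr rfl fun i hi => ?_
  rw [Finset.mem_sdiff] at hi
  rw [h2 i hi.1 hi.2]

open Classical in
/-- A function with zeros and poles at the points `α` of `S`, of order `n α`, absolute value
`C₀ ∏ |z - α| ^ n α`, and partial sums of the orders prime to the residue characteristic, such that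
the zeros of its logarithmic derivative, collected in `Z`, have values of absolute value
greater than `r`. -/
structure ChargeData (S : Finset L) (n : L → ℤ) (Z : Multiset L) (C₀ r : Γ) : Prop where
  nontriv : ∃ ε : L, ε ≠ 0 ∧ v ε < 1
  order_ne_zero : ∀ α ∈ S, n α ≠ 0
  unit : ∀ T ⊆ S, ∑ α ∈ T, n α ≠ 0 → v (∑ α ∈ T, (n α : L)) = 1
  roots : ∃ c, logNum S id (fun α => (n α : L)) = C c * (Z.map fun x => X - C x).prod
  large : ∀ z ∈ Z, r < C₀ * ∏ α ∈ S, v (z - α) ^ n α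

open Classical in
/-- The points of `S` in a closed disc. -/
noncomputable def disc (S : Finset L) (a : L) (t : Γ) : Finset L := S.filter fun α => v (α - a) ≤ t

/-- The generic absolute value on a closed disc. -/
noncomputable def gauss (S : Finset L) (n : L → ℤ) (C₀ : Γ) (a : L) (t : Γ) : Γ :=
  C₀ * ∏ α ∈ S, max t (v (a - α)) ^ n α

variable {v} {S : Finset L} {n : L → ℤ} {Z : Multiset L} {C₀ r : Γ}

lemma mem_disc {a α : L} {t : Γ} : α ∈ disc v S a t ↔ α ∈ S ∧ v (α - a) ≤ t := by
  simp [disc]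

lemma disc_subset {a : L} {t : Γ} : disc v S a t ⊆ S := fun _ h => (mem_disc.1 h).1

lemma val_eq_of_lt {x y z : L} (h : v (x - y) < v (y - z)) : v (x - z) = v (y - z) := by
  have := v.map_add_eq_of_lt_right h
  rwa [sub_add_sub_cancel] at this

lemma val_sub_le {x y z : L} {t : Γ} (h1 : v (x - y) ≤ t) (h2 : v (y - z) ≤ t) :
    v (x - z) ≤ t := by
  have := v.map_add_le h1 h2
  rwa [sub_add_sub_cancel] at this

lemma val_sub_lt {x y z : L} {t : Γ} (h1 : v (x - y) < t) (h2 : v (y - z) < t) :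
    v (x - z) < t := by
  have := v.map_add_lt h1 h2
  rwa [sub_add_sub_cancel] at this

lemma ball_eq_iff {x y : L} {t : Γ} (ht : t ≠ 0) :
    {w | v (w - x) < t} = {w | v (w - y) < t} ↔ v (x - y) < t := by
  constructor
  · intro h
    have : x ∈ {w | v (w - x) < t} := by simp [zero_lt_iff.2 ht]
    rw [h] at this
    exact this
  · intro h
    ext w
    exact ⟨fun hw => val_sub_lt hw h, fun hw => val_sub_lt hw (by rwa [Valuation.map_sub_swap])⟩

open Classical in
lemma ChargeData.card_roots (H : ChargeData v S n Z C₀ r) {a : L} {τ : L} (hτ : τ ≠ 0)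
    (hD : ∑ α ∈ disc v S a (v τ), n α ≠ 0) :
    (Z.filter fun x => v (x - a) ≤ v τ).card + 1 = (disc v S a (v τ)).card := by
  obtain ⟨c, hc⟩ := H.roots
  refine card_roots_logNum S id _ a τ hτ (fun i hi => ?_) (H.unit _ disc_subset hD) hc
  have := H.unit {i} (by simpa using hi) (by simpa using H.order_ne_zero i hi)
  rw [Finset.sum_singleton] at this
  exact this.le

open Classical in
/-- The count in an open disc with nonzero charge. -/
lemma ChargeData.card_roots_open (H : ChargeData v S n Z C₀ r) {b : L} {τ : L} (hτ : τ ≠ 0)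
    (hD : ∑ α ∈ S with v (α - b) < v τ, n α ≠ 0) :
    (Z.filter fun x => v (x - b) < v τ).card + 1 = (S.filter fun x => v (x - b) < v τ).card := by
  obtain ⟨ε, hε0, hε⟩ := H.nontriv
  -- Only finitely many points count, so the open disc may be replaced by a closed one whose radius
  -- is the largest distance that occurs. The element `τ * ε` keeps this radius nonzero.
  set T : Finset L := insert (τ * ε) (((S ∪ Z.toFinset).filter fun x => v (x - b) < v τ).image
    fun x => x - b) with hT
  obtain ⟨σ, hσ, hmax⟩ := T.exists_max_image v ⟨_, Finset.mem_insert_self _ _⟩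
  have hvτ : 0 < v τ := zero_lt_iff.2 ((Valuation.ne_zero_iff _).2 hτ)
  have hτε : v (τ * ε) < v τ := by
    rw [map_mul]; exact mul_lt_of_lt_one_right hvτ hε
  have hσ0 : σ ≠ 0 := by
    rw [← Valuation.ne_zero_iff v, ← zero_lt_iff]
    refine lt_of_lt_of_le ?_ (hmax (τ * ε) (Finset.mem_insert_self _ _))
    exact zero_lt_iff.2 ((Valuation.ne_zero_iff _).2 (mul_ne_zero hτ hε0))
  have hστ : v σ < v τ := by
    rcases Finset.mem_insert.1 hσ with rfl | h
    · exact hτε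
    · obtain ⟨x, hx, rfl⟩ := Finset.mem_image.1 h
      exact (Finset.mem_filter.1 hx).2
  have hiff : ∀ x ∈ S ∪ Z.toFinset, v (x - b) < v τ ↔ v (x - b) ≤ v σ := fun x hx =>
    ⟨fun h => hmax _ (Finset.mem_insert_of_mem (Finset.mem_image_of_mem _
      (Finset.mem_filter.2 ⟨hx, h⟩))), fun h => h.trans_lt hστ⟩
  have e1 : (S.filter fun x => v (x - b) < v τ) = disc v S b (v σ) :=
    Finset.filter_congr fun x hx => hiff x (Finset.mem_union_left _ hx)
  have e2 : (Z.filter fun x => v (x - b) < v τ) = Z.filter fun x => v (x - b) ≤ v σ :=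
    Multiset.filter_congr fun x hx => hiff x (Finset.mem_union_right _ (by simpa using hx))
  rw [e1] at hD ⊢
  rw [e2]
  exact H.card_roots hσ0 hD

open Classical in
/-- A closed disc spanned by two points of `S` on which the generic absolute value is at most `r`
has total charge zero, and it contains at least two zeros of the logarithmic derivative less than
it contains poles. -/
lemma ChargeData.neutral (H : ChargeData v S n Z C₀ r) (N : ℕ) : ∀ (a : L) (t : Γ),
    (disc v S a t).card = N → t ≠ 0 → a ∈ S → (∃ b ∈ S, v (b - a) = t) →
    gauss v S n C₀ a t ≤ r →
    ∑ α ∈ disc v S a t, n α = 0 ∧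
      (Z.filter fun x => v (x - a) ≤ t).card + 2 ≤ (disc v S a t).card := by
  induction N using Nat.strong_induction_on with
  | _ N ih =>
  intro a t hN ht ha ⟨b₀, hb₀, hb₀t⟩ hg
  obtain ⟨τ, rfl⟩ : ∃ τ, v τ = t := ⟨_, hb₀t⟩
  have hτ : τ ≠ 0 := (Valuation.ne_zero_iff v).1 ht
  set t := v τ with htdef
  set D := disc v S a t with hDdef
  have haD : a ∈ D := mem_disc.2 ⟨ha, by simp⟩
  have hb₀D : b₀ ∈ D := mem_disc.2 ⟨hb₀, hb₀t.le⟩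
  have hZ2 : (Z.filter fun x => v (x - a) ≤ t).card + 2 ≤ D.card := by
    have key := card_add_card_image_le (fun x => {w | v (w - x) < t}) D
      (Z.filter fun x => v (x - a) ≤ t) ?_ ?_
    · refine le_trans (Nat.add_le_add_left ?_ _) key
      -- The points `a` and `b₀` span the disc, so they lie in different residue classes; this gives
      -- the deficit two.
      rw [Nat.succ_le_iff, Finset.one_lt_card]
      refine ⟨_, Finset.mem_image_of_mem _ haD, _, Finset.mem_image_of_mem _ hb₀D, ?_⟩
      rw [Ne, ball_eq_iff ht, Valuation.map_sub_swap, hb₀t]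
      exact lt_irrefl _
    · -- a zero outside the residue classes of the poles has small value
      intro z hz
      rw [Multiset.mem_filter] at hz
      by_contra! hcon
      refine absurd (H.large z hz.1) (not_lt.2 (le_trans (le_of_eq ?_) hg))
      rw [gauss]
      congr 1
      refine Finset.prod_congr rfl fun α hα => ?_
      congr 1
      by_cases hαD : α ∈ D
      · have h1 := hcon α hαD
        rw [Ne, ball_eq_iff ht, not_lt] at h1
        have h2 := (mem_disc.1 hαD).2
        rw [max_eq_left (by rwa [Valuation.map_sub_swap])]
        refine le_antisymm (val_sub_le hz.2 (by rwa [Valuation.map_sub_swap])) ?_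
        rwa [Valuation.map_sub_swap]
      · have h1 : t < v (a - α) := by
          rw [Valuation.map_sub_swap]
          by_contra! h
          exact hαD (mem_disc.2 ⟨hα, h⟩)
        rw [max_eq_right h1.le]
        exact val_eq_of_lt (hz.2.trans_lt h1)
    · intro b hb
      have hbS := (mem_disc.1 hb).1
      have hba := (mem_disc.1 hb).2
      have hlt : ∀ x, v (x - b) < t → v (x - a) ≤ t := fun x hx => val_sub_le hx.le hba
      have e1 : D.filter (fun z => {w | v (w - z) < t} = {w | v (w - b) < t})
          = S.filter fun z => v (z - b) < t := by
        ext x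
        simp only [Finset.mem_filter, hDdef, mem_disc, ball_eq_iff ht]
        exact ⟨fun h => ⟨h.1.1, h.2⟩, fun h => ⟨⟨h.1, hlt x h.2⟩, h.2⟩⟩
      have e2 : (Z.filter fun x => v (x - a) ≤ t).filter
          (fun z => {w | v (w - z) < t} = {w | v (w - b) < t})
          = Z.filter fun z => v (z - b) < t := by
        rw [Multiset.filter_filter]
        refine Multiset.filter_congr fun x _ => ?_
        rw [ball_eq_iff ht]
        exact ⟨fun h => h.1, fun h => ⟨h, hlt x h⟩⟩
      suffices h : (Z.filter fun z => v (z - b) < t).card + 1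
          ≤ (S.filter fun z => v (z - b) < t).card by
        rw [← e1, ← e2] at h; convert h
      set B := S.filter fun z => v (z - b) < t with hBdef
      by_cases hB : ∑ α ∈ B, n α = 0
      swap
      · exact (H.card_roots_open hτ hB).le
      have hbB : b ∈ B := by simp [hBdef, hbS, zero_lt_iff.2 ht]
      have hBS : B ⊆ S := Finset.filter_subset _ _
      obtain ⟨b₁, hb₁, hb₁b⟩ : ∃ b₁ ∈ B, b₁ ≠ b := by
        by_contra! h
        have : B = {b} := Finset.eq_singleton_iff_unique_mem.2 ⟨hbB, h⟩
        rw [this, Finset.sum_singleton] at hB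
        exact H.order_ne_zero b hbS hB
      -- For a neutral class, pass to the smallest closed disc about `b` that contains `B`. Its
      -- generic value is that of the larger disc (`hga`, `hgb`), so induction applies to it.
      obtain ⟨b', hb', hmax⟩ := B.exists_max_image (fun x => v (x - b)) ⟨b, hbB⟩
      set t' := v (b' - b) with ht'
      have ht'0 : t' ≠ 0 := by
        rw [← zero_lt_iff]
        refine lt_of_lt_of_le ?_ (hmax b₁ hb₁)
        rw [zero_lt_iff, Valuation.ne_zero_iff]
        exact sub_ne_zero.2 hb₁b
      have ht't : t' < t := (Finset.mem_filter.1 hb').2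
      have hBdisc : disc v S b t' = B := by
        ext x
        rw [mem_disc]
        exact ⟨fun h => Finset.mem_filter.2 ⟨h.1, h.2.trans_lt ht't⟩,
          fun h => ⟨hBS h, hmax x h⟩⟩
      have hout : ∀ α ∈ S, α ∉ B → t ≤ v (b - α) := fun α hα hαB => by
        rw [Valuation.map_sub_swap]
        by_contra! h
        exact hαB (Finset.mem_filter.2 ⟨hα, h⟩)
      have hga : gauss v S n C₀ a t = C₀ * ∏ α ∈ S \ B, v (b - α) ^ n α := by
        rw [gauss]
        congr 1
        refine prod_zpow_of_neutral hBS n hB _ ht (fun α hα => ?_) fun α hα hαB => ?_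
        · refine max_eq_left ?_
          have := (Finset.mem_filter.1 hα).2
          rw [Valuation.map_sub_swap]; exact hlt α this
        · have h1 := hout α hα hαB
          rcases h1.lt_or_eq with h | h
          · have h2 : v (a - α) = v (b - α) :=
              val_eq_of_lt (lt_of_le_of_lt (by rwa [Valuation.map_sub_swap]) h)
            rw [h2, max_eq_right h1]
          · rw [← h]
            refine max_eq_left (val_sub_le (y := b) ?_ h.ge)
            rwa [Valuation.map_sub_swap]
      have hgb : gauss v S n C₀ b t' = C₀ * ∏ α ∈ S \ B, v (b - α) ^ n α := by
        rw [gauss]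
        congr 1
        refine prod_zpow_of_neutral hBS n hB _ ht'0 (fun α hα => ?_) fun α hα hαB => ?_
        · refine max_eq_left ?_
          rw [Valuation.map_sub_swap]; exact hmax α hα
        · exact max_eq_right (ht't.le.trans (hout α hα hαB))
      have hcard : B.card < N := by
        rw [← hN]
        refine Finset.card_lt_card (Finset.ssubset_iff_of_subset (fun x hx => ?_) |>.2 ?_)
        · exact mem_disc.2 ⟨hBS hx, hlt x (Finset.mem_filter.1 hx).2⟩
        · by_contra! h
          have h1 := (Finset.mem_filter.1 (h a haD)).2
          have h2 := (Finset.mem_filter.1 (h b₀ hb₀D)).2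
          rw [Valuation.map_sub_swap] at h1
          exact absurd hb₀t (val_sub_lt h2 h1).ne
      have hIH := (ih B.card hcard b t' (by rw [hBdisc]) ht'0 hbS ⟨b', hBS hb', rfl⟩
        (by rw [hgb, ← hga]; exact hg)).2
      rw [hBdisc] at hIH
      -- A zero in the annulus between the two discs would see all of `B` at one distance, hence
      -- have the generic value, which is at most `r`.
      have e3 : (Z.filter fun z => v (z - b) < t) = Z.filter fun z => v (z - b) ≤ t' := by
        refine Multiset.filter_congr fun z hz => ⟨fun h => ?_, fun h => h.trans_lt ht't⟩
        by_contra! hzt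
        refine absurd (H.large z hz) (not_lt.2 (le_trans (le_of_eq ?_) hg))
        rw [hga]
        congr 1
        have hz0 : v (z - b) ≠ 0 := (zero_le.trans_lt hzt).ne'
        refine prod_zpow_of_neutral hBS n hB _ hz0 (fun α hα => ?_) fun α hα hαB => ?_
        · have h1 := hmax α hα
          have h2 : v (α - z) = v (b - z) := val_eq_of_lt (by
            rw [Valuation.map_sub_swap v b z]; exact h1.trans_lt hzt)
          rw [Valuation.map_sub_swap, h2, Valuation.map_sub_swap]
        · exact val_eq_of_lt (h.trans_le (hout α hα hαB))
      rw [e3]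
      omega
  refine ⟨?_, hZ2⟩
  -- A nonzero charge would make the deficit exactly one.
  by_contra hne
  have : (Z.filter fun x => v (x - a) ≤ t).card + 1 = D.card := H.card_roots hτ hne
  omega

end Charges

end RatDyn

namespace RatDyn

open Polynomial

/-! ### Isolation of a simple zero -/

section Isolated

variable {L Γ : Type*} [Field L] [LinearOrderedCommGroupWithZero Γ] {v : Valuation L Γ}
  {S : Finset L} {n : L → ℤ} {Z : Multiset L} {C₀ r : Γ}

open Classical in
-- On the disc reaching the nearest charge `α₀`, the generic value is the left side of `hle`, since
-- `n a = 1`. That disc is neutral by `ChargeData.neutral`, so the generic value is unchanged at the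
-- next distance, and so on outwards.
lemma ChargeData.gauss_le (H : ChargeData v S n Z C₀ r) {a α₀ : L} (ha : a ∈ S) (hna : n a = 1)
    (hα₀ : α₀ ∈ S.erase a)
    (hle : C₀ * (∏ β ∈ S.erase a, v (a - β) ^ n β) * v (α₀ - a) ≤ r)
    (hmin : ∀ β ∈ S.erase a, v (α₀ - a) ≤ v (β - a)) (N : ℕ) :
    ∀ b ∈ S.erase a, (disc v S a (v (b - a))).card = N →
      gauss v S n C₀ a (v (b - a)) ≤ r := by
  induction N using Nat.strong_induction_on with
  | _ N ih =>
  intro b hb hN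
  have hne : ∀ β ∈ S.erase a, v (β - a) ≠ 0 := fun β hβ =>
    (Valuation.ne_zero_iff _).2 (sub_ne_zero.2 (Finset.ne_of_mem_erase hβ))
  by_cases hT : ((S.erase a).filter fun β => v (β - a) < v (b - a)).Nonempty
  · obtain ⟨β, hβ, hmax⟩ := Finset.exists_max_image _ (fun β => v (β - a)) hT
    obtain ⟨hβS, hβb⟩ := Finset.mem_filter.1 hβ
    set B := disc v S a (v (β - a)) with hB
    have hcard : B.card < N := by
      rw [← hN]
      refine Finset.card_lt_card (Finset.ssubset_iff_of_subset (fun x hx => ?_) |>.2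
        ⟨b, mem_disc.2 ⟨Finset.mem_of_mem_erase hb, le_rfl⟩, fun h => ?_⟩)
      · rw [mem_disc] at hx ⊢
        exact ⟨hx.1, hx.2.trans hβb.le⟩
      · exact absurd (mem_disc.1 h).2 (not_le.2 hβb)
    have hg := ih _ hcard β hβS rfl
    have h0 := (H.neutral _ a (v (β - a)) rfl (hne β hβS) ha
      ⟨β, Finset.mem_of_mem_erase hβS, rfl⟩ hg).1
    have hout : ∀ α ∈ S, α ∉ B → v (b - a) ≤ v (a - α) := fun α hα hαB => by
      by_contra! h
      rw [Valuation.map_sub_swap] at h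
      refine hαB (mem_disc.2 ⟨hα, ?_⟩)
      by_cases hαa : α = a
      · simp [hαa]
      · exact hmax α (Finset.mem_filter.2 ⟨Finset.mem_erase.2 ⟨hαa, hα⟩, h⟩)
    have hin : ∀ α ∈ B, v (a - α) ≤ v (β - a) := fun α hα => by
      rw [Valuation.map_sub_swap]; exact (mem_disc.1 hα).2
    refine le_trans (le_of_eq ?_) hg
    rw [gauss, gauss]
    congr 1
    rw [prod_zpow_of_neutral disc_subset n h0 (fun α => v (a - α)) (hne b hb)
        (fun α hα => max_eq_left ((hin α hα).trans hβb.le))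
        (fun α hα hαB => max_eq_right (hout α hα hαB)),
      prod_zpow_of_neutral disc_subset n h0 (fun α => v (a - α)) (hne β hβS)
        (fun α hα => max_eq_left (hin α hα))
        (fun α hα hαB => max_eq_right (hβb.le.trans (hout α hα hαB)))]
  · rw [Finset.not_nonempty_iff_eq_empty, Finset.filter_eq_empty_iff] at hT
    have hbmin : v (b - a) ≤ v (α₀ - a) := not_lt.1 (hT hα₀)
    refine le_trans ?_ hle
    rw [gauss, ← Finset.mul_prod_erase S _ ha, hna, zpow_one, sub_self, map_zero,
      max_eq_left zero_le, mul_comm (v (b - a)), ← mul_assoc]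
    have hprod : ∏ x ∈ S.erase a, max (v (b - a)) (v (a - x)) ^ n x
        = ∏ x ∈ S.erase a, v (a - x) ^ n x := by
      refine Finset.prod_congr rfl fun x hx => ?_
      rw [max_eq_right]
      rw [Valuation.map_sub_swap v a x]
      exact hbmin.trans (hmin x hx)
    rw [hprod]
    exact mul_le_mul_right hbmin _

open Classical in
/-- A simple zero is isolated in the disc on which it is expected to be the only zero. -/
lemma ChargeData.isolated (H : ChargeData v S n Z C₀ r) {a : L} (ha : a ∈ S) (hna : n a = 1)
    (htot : ∑ α ∈ S, n α = 0 → r < C₀) {α : L} (hα : α ∈ S.erase a) :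
    r < C₀ * (∏ β ∈ S.erase a, v (a - β) ^ n β) * v (α - a) := by
  by_contra! hle
  obtain ⟨α₀, hα₀, hmin⟩ := (S.erase a).exists_min_image (fun β => v (β - a)) ⟨α, hα⟩
  obtain ⟨b, hb, hmax⟩ := (S.erase a).exists_max_image (fun β => v (β - a)) ⟨α, hα⟩
  have hle' : C₀ * (∏ β ∈ S.erase a, v (a - β) ^ n β) * v (α₀ - a) ≤ r :=
    (mul_le_mul_right (hmin α hα) _).trans hle
  have hb0 : v (b - a) ≠ 0 :=
    (Valuation.ne_zero_iff _).2 (sub_ne_zero.2 (Finset.ne_of_mem_erase hb))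
  have hg := H.gauss_le ha hna hα₀ hle' hmin _ b hb rfl
  have h0 := (H.neutral _ a (v (b - a)) rfl hb0 ha ⟨b, Finset.mem_of_mem_erase hb, rfl⟩ hg).1
  have hle2 : ∀ x ∈ S, v (x - a) ≤ v (b - a) := fun x hx => by
    by_cases hxa : x = a
    · simp [hxa]
    · exact hmax x (Finset.mem_erase.2 ⟨hxa, hx⟩)
  -- The farthest charge gives a disc containing all of `S`; being neutral, it has generic value
  -- `C₀`.
  have hS : disc v S a (v (b - a)) = S :=
    Finset.filter_true_of_mem hle2
  rw [hS] at h0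
  rw [gauss, Finset.prod_congr rfl fun x hx => by
    rw [max_eq_left (by rw [Valuation.map_sub_swap]; exact hle2 x hx)],
    prod_zpow_const S n hb0, h0, zpow_zero, mul_one] at hg
  exact absurd (htot h0) (not_lt.2 hg)

end Isolated

/-! ### Charges of a quotient of polynomials -/

section Polynomials

variable {L Γ : Type*} [Field L] [LinearOrderedCommGroupWithZero Γ]

/-- The numerator of the derivative of `P / Q`. -/
noncomputable def wronsk (P Q : L[X]) : L[X] :=
  derivative P * Q - P * derivative Q

open Classical in
lemma val_eval_eq_prod [IsAlgClosed L] (v : Valuation L Γ) (F : L[X]) {S : Finset L}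
    (hS : ∀ α ∈ F.roots, α ∈ S) (x : L) :
    v (F.eval x) = v F.leadingCoeff * ∏ α ∈ S, v (x - α) ^ F.roots.count α := by
  have h1 : F.eval x = F.leadingCoeff * (F.roots.map fun a => x - a).prod :=
    (IsAlgClosed.splits F).eval_eq_prod_roots x
  rw [h1, map_mul, Finset.prod_multiset_map_count, map_prod]
  congr 1
  rw [Finset.prod_congr rfl fun α _ => map_pow v (x - α) _]
  refine Finset.prod_subset (fun α hα => hS α (by simpa using hα)) fun α _ hα => ?_
  rw [Multiset.count_eq_zero_of_notMem (by simpa using hα), pow_zero]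

open Classical in
lemma val_eval_div_eq_prod [IsAlgClosed L] (v : Valuation L Γ) (F G : L[X]) {S : Finset L}
    (hF : ∀ α ∈ F.roots, α ∈ S) (hG : ∀ α ∈ G.roots, α ∈ S) {x : L} (hFx : F.eval x ≠ 0)
    (hGx : G.eval x ≠ 0) :
    v (F.eval x / G.eval x) = v (F.leadingCoeff / G.leadingCoeff) *
      ∏ α ∈ S, v (x - α) ^ ((F.roots.count α : ℤ) - G.roots.count α) := by
  rw [map_div₀, val_eval_eq_prod v F hF, val_eval_eq_prod v G hG, map_div₀, mul_div_mul_comm,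
    ← Finset.prod_div_distrib]
  congr 1
  refine Finset.prod_congr rfl fun α _ => ?_
  by_cases hx : x = α
  · subst hx
    rw [Multiset.count_eq_zero_of_notMem (fun h => hFx (mem_roots'.1 h).2),
      Multiset.count_eq_zero_of_notMem (fun h => hGx (mem_roots'.1 h).2)]
    simp
  · rw [zpow_sub₀ ((Valuation.ne_zero_iff _).2 (sub_ne_zero.2 hx)), zpow_natCast, zpow_natCast]

open Classical in
lemma eval_derivative_div [IsAlgClosed L] (F : L[X]) {S : Finset L}
    (hF : ∀ α ∈ F.roots, α ∈ S) {x : L}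
    (hFx : F.eval x ≠ 0) :
    F.derivative.eval x / F.eval x = ∑ α ∈ S, (F.roots.count α : L) * (x - α)⁻¹ := by
  rw [(IsAlgClosed.splits F).eval_derivative_div_eval_of_ne_zero hFx,
    Finset.sum_multiset_map_count]
  rw [Finset.sum_congr rfl fun α _ => by rw [nsmul_eq_mul, one_div]]
  refine Finset.sum_subset (fun α hα => hF α (by simpa using hα)) fun α _ hα => ?_
  rw [Multiset.count_eq_zero_of_notMem (by simpa using hα), Nat.cast_zero, zero_mul]

open Classical in
lemma sum_count_roots_le (F : L[X]) {S T : Finset L} (hF : ∀ α ∈ F.roots, α ∈ S) (hT : T ⊆ S) :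
    ∑ α ∈ T, F.roots.count α ≤ F.natDegree :=
  (Finset.sum_le_sum_of_subset hT).trans
    ((Multiset.sum_count_eq_card hF).le.trans (card_roots' F))

open Classical in
lemma sum_count_roots [IsAlgClosed L] (F : L[X]) {S : Finset L} (hF : ∀ α ∈ F.roots, α ∈ S) :
    ∑ α ∈ S, F.roots.count α = F.natDegree := by
  rw [Multiset.sum_count_eq_card hF, (IsAlgClosed.splits F).natDegree_eq_card_roots]

open Classical in
lemma eval_logNum (S : Finset L) (n : L → L) (x : L) :
    (logNum S id n).eval x = ∑ i ∈ S, n i * ∏ j ∈ S.erase i, (x - j) := by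
  simp [logNum, eval_finsetSum, eval_prod]

open Classical in
lemma eval_logNum_of_notMem {S : Finset L} (n : L → L) {x : L} (hx : x ∉ S) :
    (logNum S id n).eval x = (∏ j ∈ S, (x - j)) * ∑ i ∈ S, n i * (x - i)⁻¹ := by
  rw [eval_logNum, Finset.mul_sum]
  refine Finset.sum_congr rfl fun i hi => ?_
  rw [← Finset.mul_prod_erase S _ hi]
  have : x - i ≠ 0 := sub_ne_zero.2 (fun h => hx (h ▸ hi))
  field_simp

open Classical in
lemma eval_logNum_of_mem {S : Finset L} (n : L → L) {x : L} (hx : x ∈ S) :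
    (logNum S id n).eval x = n x * ∏ j ∈ S.erase x, (x - j) := by
  rw [eval_logNum, Finset.sum_eq_single_of_mem x hx fun i _ hix => ?_]
  rw [Finset.prod_eq_zero (i := x) (by simp [hx, Ne.symm hix]) (sub_self x), mul_zero]

open Classical in
/-- Zeros and poles of `P / Q`, with the zeros of its logarithmic derivative. -/
lemma chargeData_of_coprime [IsAlgClosed L] {v : Valuation L Γ}
    (hv : ∃ ε : L, ε ≠ 0 ∧ v ε < 1) {d : ℕ}
    (hunit : ∀ m : ℤ, m ≠ 0 → |m| ≤ d → v (m : L) = 1) {P Q : L[X]} (hcop : IsCoprime P Q)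
    (hP0 : P ≠ 0) (hQ0 : Q ≠ 0)
    (hP : P.natDegree ≤ d) (hQ : Q.natDegree ≤ d) {r : Γ}
    (hcrit : ∀ x, (wronsk P Q).eval x = 0 → Q.eval x ≠ 0 → v (P.eval x / Q.eval x) ≤ r →
      P.eval x = 0) {S : Finset L} (hS : S = P.roots.toFinset ∪ Q.roots.toFinset) :
    ChargeData v S (fun α => (P.roots.count α : ℤ) - Q.roots.count α)
      (logNum S id fun α => (((P.roots.count α : ℤ) - Q.roots.count α : ℤ) : L)).roots
      (v (P.leadingCoeff / Q.leadingCoeff)) r := by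
  have hPS : ∀ α ∈ P.roots, α ∈ S := fun α h => by simp [hS]; left; exact mem_roots'.1 h
  have hQS : ∀ α ∈ Q.roots, α ∈ S := fun α h => by simp [hS]; right; exact mem_roots'.1 h
  set n : L → ℤ := fun α => (P.roots.count α : ℤ) - Q.roots.count α with hn
  have hunit' : ∀ T ⊆ S, ∑ α ∈ T, n α ≠ 0 → v (∑ α ∈ T, (n α : L)) = 1 := by
    intro T hT h0
    rw [← Int.cast_sum]
    refine hunit _ h0 ?_
    have h1 := sum_count_roots_le P hPS hT
    have h2 := sum_count_roots_le Q hQS hT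
    have h3 : ∑ α ∈ T, n α = ((∑ α ∈ T, P.roots.count α : ℕ) : ℤ)
        - ((∑ α ∈ T, Q.roots.count α : ℕ) : ℤ) := by
      push_cast; rw [hn, Finset.sum_sub_distrib]
    rw [h3, abs_le]
    constructor <;> omega
  have hroot : ∀ α ∈ S, (P.eval α = 0 ∧ Q.eval α ≠ 0) ∨ (P.eval α ≠ 0 ∧ Q.eval α = 0) := by
    intro α hα
    have hne : ¬ (P.eval α = 0 ∧ Q.eval α = 0) := by
      rintro ⟨h1, h2⟩
      obtain ⟨u, w, huw⟩ := hcop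
      have := congrArg (eval α) huw
      simp [h1, h2] at this
    have : P.eval α = 0 ∨ Q.eval α = 0 := by
      rw [hS] at hα
      simp only [Finset.mem_union, Multiset.mem_toFinset, mem_roots'] at hα
      exact hα.imp (fun h => h.2) (fun h => h.2)
    tauto
  have hne : ∀ α ∈ S, n α ≠ 0 := by
    intro α hα
    simp only [hn]
    rcases hroot α hα with ⟨h1, h2⟩ | ⟨h1, h2⟩
    · have h3 : 0 < P.roots.count α := Multiset.count_pos.2 (mem_roots'.2 ⟨hP0, h1⟩)
      have h4 : Q.roots.count α = 0 :=
        Multiset.count_eq_zero_of_notMem (fun h => h2 (mem_roots'.1 h).2)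
      omega
    · have h3 : 0 < Q.roots.count α := Multiset.count_pos.2 (mem_roots'.2 ⟨hQ0, h2⟩)
      have h4 : P.roots.count α = 0 :=
        Multiset.count_eq_zero_of_notMem (fun h => h1 (mem_roots'.1 h).2)
      omega
  refine ⟨hv, hne, hunit', ⟨_, (IsAlgClosed.splits _).eq_prod_roots⟩, fun z hz => ?_⟩
  have hz0 := (mem_roots'.1 hz).2
  rw [IsRoot.def] at hz0
  have hzS : z ∉ S := by
    intro hzS
    rw [eval_logNum_of_mem _ hzS] at hz0
    rcases mul_eq_zero.1 hz0 with h | h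
    · have := hunit' {z} (by simpa using hzS) (by simpa using hne z hzS)
      rw [Finset.sum_singleton] at this
      simp only [hn] at this
      rw [h, map_zero] at this
      exact zero_ne_one this
    · obtain ⟨j, hj, hj0⟩ := Finset.prod_eq_zero_iff.1 h
      exact Finset.ne_of_mem_erase hj (sub_eq_zero.1 hj0).symm
  have hPz : P.eval z ≠ 0 := fun h => hzS (hPS z (mem_roots'.2 ⟨hP0, h⟩))
  have hQz : Q.eval z ≠ 0 := fun h => hzS (hQS z (mem_roots'.2 ⟨hQ0, h⟩))
  rw [← val_eval_div_eq_prod v P Q hPS hQS hPz hQz]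
  by_contra! hle
  refine hPz (hcrit z ?_ hQz hle)
  -- Off `S`, a zero of `logNum` is a zero of `P'/P - Q'/Q`, hence of the Wronskian.
  rw [eval_logNum_of_notMem _ hzS] at hz0
  have hsum := (mul_eq_zero.1 hz0).resolve_left
    (Finset.prod_ne_zero_iff.2 fun j hj => sub_ne_zero.2 fun h => hzS (h ▸ hj))
  have h1 := eval_derivative_div P hPS hPz
  have h2 := eval_derivative_div Q hQS hQz
  have h3 : P.derivative.eval z / P.eval z = Q.derivative.eval z / Q.eval z := by
    rw [h1, h2, ← sub_eq_zero, ← Finset.sum_sub_distrib, ← hsum]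
    refine Finset.sum_congr rfl fun i _ => ?_
    push_cast; ring
  rw [div_eq_div_iff hPz hQz] at h3
  simp only [wronsk, eval_sub, eval_mul]
  rw [h3]; ring

open Classical in
/-- If all critical values of `f = P / Q` of absolute value at most `r` are zero, then near a simple
zero `a` of `f` the function `f` has no other zero and no pole where `|f'(a)| |x - a| ≤ r`. -/
lemma isolated_zero [IsAlgClosed L] {v : Valuation L Γ} (hv : ∃ ε : L, ε ≠ 0 ∧ v ε < 1) {d : ℕ}
    (hunit : ∀ m : ℤ, m ≠ 0 → |m| ≤ d → v (m : L) = 1) {P Q : L[X]} (hcop : IsCoprime P Q)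
    (hP : P.natDegree ≤ d) (hQ : Q.natDegree ≤ d) {r : Γ}
    (hcrit : ∀ x, (wronsk P Q).eval x = 0 → Q.eval x ≠ 0 → v (P.eval x / Q.eval x) ≤ r →
      P.eval x = 0)
    (hinf : P.natDegree = Q.natDegree → r < v (P.leadingCoeff / Q.leadingCoeff))
    {a : L} (ha : P.eval a = 0) (hWa : (wronsk P Q).eval a ≠ 0) {x : L}
    (hx : v ((wronsk P Q).eval a / Q.eval a ^ 2) * v (x - a) ≤ r) :
    Q.eval x ≠ 0 ∧ (P.eval x = 0 → x = a) ∧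
      v (P.eval x / Q.eval x) = v ((wronsk P Q).eval a / Q.eval a ^ 2) * v (x - a) := by
  have hWa' : (wronsk P Q).eval a = P.derivative.eval a * Q.eval a := by
    simp [wronsk, ha]
  have hQa : Q.eval a ≠ 0 := fun h => hWa (by rw [hWa', h, mul_zero])
  have hQ0 : Q ≠ 0 := by rintro rfl; simp at hQa
  have hP0 : P ≠ 0 := by rintro rfl; simp [wronsk] at hWa
  by_cases hxa : x = a
  · subst hxa
    exact ⟨hQa, fun _ => rfl, by simp [ha]⟩
  obtain ⟨P₁, hP₁⟩ := dvd_iff_isRoot.2 (show IsRoot P a from ha)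
  have hP₁0 : P₁ ≠ 0 := by rintro rfl; simp at hP₁; exact hP0 hP₁
  have hder : P.derivative.eval a = P₁.eval a := by simp [hP₁]
  have hP₁a : P₁.eval a ≠ 0 := fun h => hWa (by rw [hWa', hder, h, zero_mul])
  have hroots : P.roots = {a} + P₁.roots := by
    rw [hP₁, roots_mul (hP₁ ▸ hP0), roots_X_sub_C]
  obtain ⟨S, hS⟩ : ∃ S, S = P.roots.toFinset ∪ Q.roots.toFinset := ⟨_, rfl⟩
  have H := chargeData_of_coprime hv hunit hcop hP0 hQ0 hP hQ hcrit hS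
  have hPS : ∀ α ∈ P.roots, α ∈ S := fun α h => by simp [hS]; left; exact mem_roots'.1 h
  have hQS : ∀ α ∈ Q.roots, α ∈ S := fun α h => by simp [hS]; right; exact mem_roots'.1 h
  have haS : a ∈ S := hPS a (mem_roots'.2 ⟨hP0, ha⟩)
  have hcP₁ : P₁.roots.count a = 0 :=
    Multiset.count_eq_zero_of_notMem fun h => hP₁a (mem_roots'.1 h).2
  have hcQ : Q.roots.count a = 0 :=
    Multiset.count_eq_zero_of_notMem fun h => hQa (mem_roots'.1 h).2
  have hna : (P.roots.count a : ℤ) - Q.roots.count a = 1 := by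
    rw [hroots, Multiset.count_add, hcP₁, hcQ]; simp
  -- The derivative at the simple zero is the value at `a` of the quotient with the factor `X - a`
  -- removed.
  have hlam : v ((wronsk P Q).eval a / Q.eval a ^ 2) = v (P.leadingCoeff / Q.leadingCoeff) *
      ∏ β ∈ S.erase a, v (a - β) ^ ((P.roots.count β : ℤ) - Q.roots.count β) := by
    have h1 : (wronsk P Q).eval a / Q.eval a ^ 2 = P₁.eval a / Q.eval a := by
      rw [hWa', hder]; field_simp
    rw [h1, val_eval_div_eq_prod v P₁ Q (fun α h => hPS α (by rw [hroots]; simp [h])) hQS hP₁a hQa,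
      ← Finset.mul_prod_erase S _ haS, hcP₁, hcQ]
    have h2 : P.leadingCoeff = P₁.leadingCoeff := by rw [hP₁]; simp
    rw [h2]
    simp only [CharP.cast_eq_zero, sub_self, zpow_zero, one_mul]
    congr 1
    refine Finset.prod_congr rfl fun β hβ => ?_
    rw [hroots, Multiset.count_add, Multiset.count_singleton,
      if_neg (Finset.ne_of_mem_erase hβ), zero_add]
  -- Total charge zero means equal degrees, and then `C₀` is the absolute value at infinity,
  -- controlled by `hinf`.
  have hiso := fun α hα => H.isolated haS hna (fun h0 => hinf (by
    rw [Finset.sum_sub_distrib, ← Nat.cast_sum, ← Nat.cast_sum, sum_count_roots P hPS,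
      sum_count_roots Q hQS] at h0
    omega)) (α := α) hα
  rw [← hlam] at hiso
  -- Every other charge is farther from `a` than `x` is, so `x` and `a` see it at the same distance.
  have hlt : ∀ α ∈ S.erase a, v (x - a) < v (a - α) := fun α hα => by
    rw [Valuation.map_sub_swap v a α]
    exact lt_of_mul_lt_mul_left (hx.trans_lt (hiso α hα)) zero_le
  have hxS : x ∉ S := fun h => by
    have := hlt x (Finset.mem_erase.2 ⟨hxa, h⟩)
    rw [Valuation.map_sub_swap] at this
    exact lt_irrefl _ this
  have hPx : P.eval x ≠ 0 := fun h => hxS (hPS x (mem_roots'.2 ⟨hP0, h⟩))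
  have hQx : Q.eval x ≠ 0 := fun h => hxS (hQS x (mem_roots'.2 ⟨hQ0, h⟩))
  refine ⟨hQx, fun h => absurd h hPx, ?_⟩
  rw [val_eval_div_eq_prod v P Q hPS hQS hPx hQx, hlam, ← Finset.mul_prod_erase S _ haS, hna,
    zpow_one, mul_assoc, mul_comm (v (x - a))]
  congr 2
  refine Finset.prod_congr rfl fun α hα => ?_
  rw [val_eq_of_lt (hlt α hα)]

end Polynomials

end RatDyn

namespace RatDyn

open Polynomial

/-! ### Pulling back discs along an attracting cycle -/

section Dynamics

variable {L Γ : Type*} [Field L] [LinearOrderedCommGroupWithZero Γ]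

/-- A pair of coprime polynomials `P, Q` over a valued field, with a periodic orbit `γ` of `P / Q`
that avoids infinity and consists of noncritical points, and a finite forward invariant set `E`
that contains the finite critical points and, if it is finite, the image of infinity. -/
structure CycleData (v : Valuation L Γ) (d : ℕ) (P Q : L[X]) (γ : ℕ → L) (n : ℕ) (E : Set L) :
    Prop where
  unit : ∀ m : ℤ, m ≠ 0 → |m| ≤ d → v (m : L) = 1
  coprime : IsCoprime P Q
  degP : P.natDegree ≤ d
  degQ : Q.natDegree ≤ d
  denom : ∀ i, Q.eval (γ i) ≠ 0
  orbit : ∀ i, P.eval (γ i) / Q.eval (γ i) = γ (i + 1)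
  periodic : ∀ i, γ (i + n) = γ i
  noncrit : ∀ i, (wronsk P Q).eval (γ i) ≠ 0
  finite : E.Finite
  crit : ∀ x, (wronsk P Q).eval x = 0 → x ∈ E
  invariant : ∀ x ∈ E, Q.eval x ≠ 0 → P.eval x / Q.eval x ∈ E
  infty : P.natDegree ≤ Q.natDegree → P.coeff Q.natDegree / Q.leadingCoeff ∈ E

/-- The derivative of `P / Q`. -/
noncomputable def slope (P Q : L[X]) (x : L) : L := (wronsk P Q).eval x / Q.eval x ^ 2

variable {v : Valuation L Γ} {d : ℕ} {P Q : L[X]} {γ : ℕ → L} {n : ℕ} {E : Set L}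

lemma CycleData.slope_ne_zero (H : CycleData v d P Q γ n E) (i : ℕ) : slope P Q (γ i) ≠ 0 :=
  div_ne_zero (H.noncrit i) (pow_ne_zero _ (H.denom i))

/-- This is `isolated_zero` for `P / Q - γ (i + 1)`, which has the same Wronskian. Critical values
and the value at infinity lie in `E`, so `hE` excludes them from the target disc, except for its
centre; infinity cannot take the central value when the degrees agree. -/
lemma CycleData.step [IsAlgClosed L] (H : CycleData v d P Q γ n E)
    (hv : ∃ ε : L, ε ≠ 0 ∧ v ε < 1) {ρ : Γ} {i : ℕ}
    (hE : ∀ x ∈ E, v (x - γ (i + 1)) ≤ ρ → x = γ (i + 1)) {x : L}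
    (hx : v (slope P Q (γ i)) * v (x - γ i) ≤ ρ) :
    Q.eval x ≠ 0 ∧ (P.eval x / Q.eval x = γ (i + 1) → x = γ i) ∧
      v (P.eval x / Q.eval x - γ (i + 1)) ≤ ρ := by
  set y := γ (i + 1) with hy
  set R := P - C y * Q with hR
  have hW : wronsk R Q = wronsk P Q := by
    simp only [wronsk, hR, derivative_sub, derivative_C_mul]; ring
  have hQ0 : Q ≠ 0 := by
    intro h; have := H.denom i; simp [h] at this
  have hR0 : R ≠ 0 := by
    intro h
    have := H.noncrit i
    rw [← hW, h] at this
    simp [wronsk] at this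
  have hdiv : ∀ z, Q.eval z ≠ 0 → R.eval z / Q.eval z = P.eval z / Q.eval z - y := fun z hz => by
    simp only [hR, eval_sub, eval_mul, eval_C]; field_simp
  have hcop : IsCoprime R Q := by
    have := H.coprime.add_mul_right_left (-C y)
    rwa [neg_mul, ← sub_eq_add_neg] at this
  have hCQ : (C y * Q).natDegree ≤ Q.natDegree := natDegree_C_mul_le _ _
  have hRdeg : R.natDegree ≤ d :=
    (natDegree_sub_le _ _).trans (max_le H.degP (hCQ.trans H.degQ))
  have hRγ : R.eval (γ i) = 0 := by
    have := hdiv _ (H.denom i)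
    rw [H.orbit i, sub_self] at this
    exact (div_eq_zero_iff.1 this).resolve_right (H.denom i)
  have main := isolated_zero (v := v) hv H.unit hcop hRdeg H.degQ (r := ρ) ?_ ?_ hRγ
    (by rw [hW]; exact H.noncrit i) (x := x) (by rw [hW]; exact hx)
  · obtain ⟨h1, h2, h3⟩ := main
    refine ⟨h1, fun h => h2 ?_, ?_⟩
    · have := hdiv x h1
      rw [h, sub_self] at this
      exact (div_eq_zero_iff.1 this).resolve_right h1
    · rw [← hdiv x h1, h3, hW]; exact hx
  · intro z hz hQz hzρ
    rw [hW] at hz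
    rw [hdiv z hQz] at hzρ
    have := hE _ (H.invariant z (H.crit z hz) hQz) hzρ
    have h2 := hdiv z hQz
    rw [this, sub_self] at h2
    exact (div_eq_zero_iff.1 h2).resolve_right hQz
  · intro hdeg
    have hPdeg : P.natDegree ≤ Q.natDegree := by
      have : P = R + C y * Q := by rw [hR]; ring
      rw [this]
      exact (natDegree_add_le _ _).trans (max_le hdeg.le hCQ)
    have hlq : Q.leadingCoeff ≠ 0 := leadingCoeff_ne_zero.2 hQ0
    have hlead : R.leadingCoeff / Q.leadingCoeff
        = P.coeff Q.natDegree / Q.leadingCoeff - y := by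
      rw [leadingCoeff, hdeg, hR, coeff_sub, coeff_C_mul, coeff_natDegree]
      field_simp
    by_contra! hle
    rw [hlead] at hle
    have := hE _ (H.infty hPdeg) hle
    rw [this, sub_self] at hlead
    exact leadingCoeff_ne_zero.2 hR0 ((div_eq_zero_iff.1 hlead).resolve_right hlq)

/-- A point of `E` in the pulled-back disc maps to a point of `E` in the previous disc, that is, to
its centre; by `CycleData.step` the centre has only one preimage there. -/
lemma CycleData.pullback [IsAlgClosed L] (H : CycleData v d P Q γ n E)
    (hv : ∃ ε : L, ε ≠ 0 ∧ v ε < 1) {ρ : Γ}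
    (hE : ∀ i, ∀ x ∈ E, v (x - γ i) ≤ ρ → x = γ i) (m : ℕ) :
    ∀ i, ∀ x ∈ E, v (∏ j ∈ Finset.range m, slope P Q (γ (i + j))) * v (x - γ i) ≤ ρ → x = γ i := by
  induction m with
  | zero => simpa using hE
  | succ m ih =>
    intro i x hxE hx
    set Λ := ∏ j ∈ Finset.range m, slope P Q (γ (i + 1 + j)) with hΛ
    have hprod : ∏ j ∈ Finset.range (m + 1), slope P Q (γ (i + j))
        = Λ * slope P Q (γ i) := by
      rw [Finset.prod_range_succ', hΛ, add_zero]
      congr 1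
      exact Finset.prod_congr rfl fun j _ => by rw [show i + (j + 1) = i + 1 + j by ring]
    have hΛ0 : 0 < v Λ := zero_lt_iff.2 ((Valuation.ne_zero_iff _).2
      (Finset.prod_ne_zero_iff.2 fun j _ => H.slope_ne_zero _))
    obtain ⟨h1, h2, h3⟩ := H.step hv (ρ := ρ / v Λ) (i := i) (x := x)
      (fun z hz hzρ => ih (i + 1) z hz (by rwa [le_div_iff₀' hΛ0] at hzρ))
      (by rw [le_div_iff₀' hΛ0, ← mul_assoc, ← map_mul, ← hprod]; exact hx)
    refine h2 (ih (i + 1) _ (H.invariant x hxE h1) ?_)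
    rwa [le_div_iff₀' hΛ0] at h3

lemma CycleData.exists_radius (H : CycleData v d P Q γ n E) (hn : 0 < n) {ε : L} (hε0 : ε ≠ 0)
    (hε : v ε < 1) : ∃ ρ : L, ρ ≠ 0 ∧ ∀ i, ∀ x ∈ E, v (x - γ i) ≤ v ρ → x = γ i := by
  classical
  set T : Finset L := insert 1 (((H.finite.toFinset ×ˢ Finset.range n).image
    fun z => z.1 - γ z.2).erase 0) with hT
  obtain ⟨σ, hσ, hmin⟩ := T.exists_min_image v ⟨1, Finset.mem_insert_self _ _⟩
  have hσ0 : σ ≠ 0 := by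
    rcases Finset.mem_insert.1 hσ with rfl | h
    · exact one_ne_zero
    · exact Finset.ne_of_mem_erase h
  -- `v σ` bounds the nonzero distances from below; the factor `ε` makes the radius strictly
  -- smaller.
  refine ⟨σ * ε, mul_ne_zero hσ0 hε0, fun i x hx hle => ?_⟩
  have hi : γ i = γ (i % n) := (Function.Periodic.map_mod_nat H.periodic i).symm
  by_contra hne
  rw [hi] at hle hne
  have := hmin (x - γ (i % n)) (Finset.mem_insert_of_mem (Finset.mem_erase.2
    ⟨sub_ne_zero.2 hne, Finset.mem_image.2 ⟨(x, i % n), by simp [hx, Nat.mod_lt _ hn], rfl⟩⟩))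
  refine absurd (this.trans hle) (not_le.2 ?_)
  rw [map_mul]
  exact mul_lt_of_lt_one_right (zero_lt_iff.2 ((Valuation.ne_zero_iff _).2 hσ0)) hε

lemma natDegree_eq_zero_of_no_root [IsAlgClosed L] {F : L[X]} (h : ∀ x, F.eval x ≠ 0) :
    F.natDegree = 0 := by
  by_contra hF
  obtain ⟨x, hx⟩ := IsAlgClosed.exists_root F (fun h0 => hF (natDegree_eq_of_degree_eq_some h0))
  exact h x hx

lemma prod_range_mul_of_periodic {M : Type*} [CommMonoid M] {f : ℕ → M} {n : ℕ}
    (hf : ∀ i, f (i + n) = f i) (k : ℕ) :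
    ∏ j ∈ Finset.range (n * k), f j = (∏ j ∈ Finset.range n, f j) ^ k := by
  induction k with
  | zero => simp
  | succ k ih =>
    rw [Nat.mul_succ, Finset.prod_range_add, ih, pow_succ]
    congr 1
    refine Finset.prod_congr rfl fun j _ => ?_
    have := (Function.Periodic.nat_mul (f := f) (c := n) hf k) j
    rw [add_comm, mul_comm]
    simpa using this

/-- In a valued field in which the powers of the multiplier `l` are cofinal, an attracting
cycle whose multiplier is not zero cannot exist under the hypotheses of `CycleData`. -/
theorem CycleData.false_of_attracting [IsAlgClosed L] (H : CycleData v d P Q γ n E) (hn : 0 < n)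
    (hdeg : 2 ≤ max P.natDegree Q.natDegree) {l : L}
    (hl : l = ∏ j ∈ Finset.range n, slope P Q (γ j)) (hl1 : v l < 1)
    (harch : ∀ x : L, ∃ k : ℕ, v l ^ k * v x ≤ 1) : False := by
  have hl0 : l ≠ 0 := hl ▸ Finset.prod_ne_zero_iff.2 fun j _ => H.slope_ne_zero _
  have hv : ∃ ε : L, ε ≠ 0 ∧ v ε < 1 := ⟨l, hl0, hl1⟩
  obtain ⟨ρ, hρ0, hρ⟩ := H.exists_radius hn hl0 hl1
  have hvρ : 0 < v ρ := zero_lt_iff.2 ((Valuation.ne_zero_iff _).2 hρ0)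
  have hall : ∀ x, Q.eval x ≠ 0 ∧ (P.eval x / Q.eval x = γ 1 → x = γ 0) := by
    intro x
    obtain ⟨k, hk⟩ := harch ((x - γ 0) / ρ)
    rw [map_div₀, ← mul_div_assoc, div_le_one₀ hvρ] at hk
    -- One extra turn makes the number of steps positive: `m` of them are pulled back to `γ 1`, and
    -- the last, from `γ 1` to `γ 0`, is made by `CycleData.step`, which also excludes poles.
    obtain ⟨m, hm⟩ : ∃ m, n * (k + 1) = m + 1 :=
      ⟨n * (k + 1) - 1, (Nat.sub_add_cancel (Nat.mul_pos hn k.succ_pos)).symm⟩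
    have hper : ∏ j ∈ Finset.range (m + 1), slope P Q (γ j) = l ^ (k + 1) := by
      rw [← hm, hl]
      exact prod_range_mul_of_periodic (fun i => by rw [H.periodic]) (k + 1)
    rw [Finset.prod_range_succ'] at hper
    set Λ := ∏ j ∈ Finset.range m, slope P Q (γ (j + 1)) with hΛ
    have hΛ0 : 0 < v Λ := zero_lt_iff.2 ((Valuation.ne_zero_iff _).2
      (Finset.prod_ne_zero_iff.2 fun j _ => H.slope_ne_zero _))
    obtain ⟨h1, h2, -⟩ := H.step hv (ρ := v ρ / v Λ) (i := 0) (x := x)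
      (fun z hz hzρ => H.pullback hv hρ m 1 z hz (by
        rw [le_div_iff₀' hΛ0] at hzρ
        simpa only [hΛ, add_comm] using hzρ))
      (by
        rw [le_div_iff₀' hΛ0, ← mul_assoc, ← map_mul, hper, map_pow, pow_succ]
        refine le_trans ?_ hk
        exact mul_le_mul_left (mul_le_of_le_one_right zero_le hl1.le) _)
    exact ⟨h1, h2⟩
  have hQdeg : Q.natDegree = 0 := natDegree_eq_zero_of_no_root fun x => (hall x).1
  set R := P - C (γ 1) * Q with hR
  have hRγ : R.eval (γ 0) = 0 := by
    have := H.orbit 0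
    rw [div_eq_iff (H.denom 0)] at this
    simp [hR, this]
  obtain ⟨R₁, hR₁⟩ := dvd_iff_isRoot.2 (show IsRoot R (γ 0) from hRγ)
  have hR₁γ : R₁.eval (γ 0) ≠ 0 := by
    intro h
    apply H.noncrit 0
    have h1 : R.derivative.eval (γ 0) = 0 := by rw [hR₁]; simp [h]
    have h2 : wronsk P Q = derivative R * Q - R * derivative Q := by
      simp only [wronsk, hR, derivative_sub, derivative_C_mul]; ring
    rw [h2, eval_sub, eval_mul, eval_mul, h1, hRγ]; ring
  have hR₁deg : R₁.natDegree = 0 := natDegree_eq_zero_of_no_root fun x hx => by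
    have h1 : R.eval x = 0 := by rw [hR₁, eval_mul, hx, mul_zero]
    have h2 := (hall x).2 (by
      rw [div_eq_iff (hall x).1]
      rw [hR, eval_sub, eval_mul, eval_C, sub_eq_zero] at h1
      exact h1)
    rw [h2] at hx
    exact hR₁γ hx
  have hPdeg : P.natDegree ≤ 1 := by
    have h1 : P = (X - C (γ 0)) * R₁ + C (γ 1) * Q := by rw [← hR₁, hR]; ring
    rw [h1]
    refine (natDegree_add_le _ _).trans (max_le ?_ ?_)
    · refine natDegree_mul_le.trans ?_
      rw [hR₁deg, natDegree_X_sub_C]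
    · exact (natDegree_C_mul_le _ _).trans (by omega)
  omega

end Dynamics

end RatDyn

namespace RatDyn

open Polynomial

/-! ### A valuation for which a transcendental element is small -/

section ExistsValuation

/-- Extend `l` to a transcendence basis and adjoin its other elements to `F`; then `L` is algebraic
over `k[l]`. -/
lemma exists_intermediateField_transcendental {F L : Type*} [Field F] [Field L] [Algebra F L]
    {l : L} (hl : Transcendental F l) :
    ∃ k : IntermediateField F L, Transcendental k l ∧
      ∀ x : L, ∃ p : L[X], p ≠ 0 ∧ (∀ i, p.coeff i ∈ Algebra.adjoin k {l}) ∧ p.eval x = 0 := by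
  have h1 : AlgebraicIndepOn F id ({l} : Set L) :=
    (algebraicIndependent_singleton_iff (⟨l, rfl⟩ : ({l} : Set L))).2 hl
  obtain ⟨t, hlt, ht⟩ := exists_isTranscendenceBasis_superset h1
  have hlt' : l ∈ t := hlt rfl
  set s : Set t := {(⟨l, hlt'⟩ : t)}ᶜ
  refine ⟨IntermediateField.adjoin F (Subtype.val '' s), ?_, fun x => ?_⟩
  · rw [IntermediateField.transcendental_adjoin_iff]
    exact ht.1.transcendental_adjoin (i := ⟨l, hlt'⟩) (by simp [s])
  · have := ht.isAlgebraic
    obtain ⟨p, hp0, hp⟩ := this.isAlgebraic x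
    refine ⟨p.map (algebraMap _ L), ?_, fun i => ?_, by rwa [eval_map_algebraMap]⟩
    · rwa [Ne, Polynomial.map_eq_zero_iff]
      exact Subtype.val_injective
    · rw [coeff_map]
      obtain ⟨c, hc⟩ := p.coeff i
      change c ∈ _
      have hle : Algebra.adjoin F (Set.range (Subtype.val : t → L)) ≤
          (Algebra.adjoin (IntermediateField.adjoin F (Subtype.val '' s)) {l}).restrictScalars
            F := by
        refine Algebra.adjoin_le ?_
        rintro _ ⟨y, rfl⟩
        change (y : L) ∈ Algebra.adjoin (IntermediateField.adjoin F (Subtype.val '' s)) {l}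
        by_cases hy : (y : L) = l
        · rw [hy]; exact Algebra.subset_adjoin rfl
        · refine Subalgebra.algebraMap_mem _
            (⟨y, IntermediateField.subset_adjoin F _ ⟨y, ?_, rfl⟩⟩ :
              IntermediateField.adjoin F (Subtype.val '' s))
          simp only [s, Set.mem_compl_iff, Set.mem_singleton_iff]
          intro h
          exact hy (congrArg Subtype.val h)
      exact hle hc

/-- With `N + 1` the degree, the lower terms have absolute value at most `v x ^ N`, so the leading
term does too. -/
lemma val_root_bound {L Γ : Type*} [Field L] [LinearOrderedCommGroupWithZero Γ]
    (v : Valuation L Γ) {p : L[X]} (hp : p ≠ 0) (hint : ∀ i, v (p.coeff i) ≤ 1) {x : L}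
    (hx : p.eval x = 0) (hx1 : 1 < v x) : v p.leadingCoeff * v x ≤ 1 := by
  have hvx : 0 < v x := zero_lt_one.trans hx1
  obtain ⟨N, hN⟩ : ∃ N, p.natDegree = N + 1 := by
    refine Nat.exists_eq_succ_of_ne_zero fun h0 => ?_
    rw [eq_C_of_natDegree_eq_zero h0, eval_C] at hx
    apply hp
    rw [eq_C_of_natDegree_eq_zero h0, hx, C_0]
  rw [eval_eq_sum_range, Finset.sum_range_succ, add_comm, add_eq_zero_iff_eq_neg] at hx
  have h1 : v (p.coeff p.natDegree * x ^ p.natDegree) ≤ v x ^ N := by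
    rw [hx, Valuation.map_neg]
    refine v.map_sum_le fun i hi => ?_
    rw [Finset.mem_range, hN] at hi
    rw [map_mul, map_pow]
    calc v (p.coeff i) * v x ^ i ≤ 1 * v x ^ i := mul_le_mul_left (hint i) _
      _ = v x ^ i := one_mul _
      _ ≤ v x ^ N := pow_le_pow_right₀ hx1.le (Nat.lt_succ_iff.1 hi)
  rw [map_mul, map_pow, hN, pow_succ', ← mul_assoc] at h1
  rw [leadingCoeff, hN]
  exact le_of_mul_le_mul_right (by rwa [one_mul]) (pow_pos hvx N)

/-- A transcendental element `l` is small for some valuation that is trivial on the constants and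
for which the powers of `l` are cofinal. -/
theorem exists_valuationSubring {F L : Type*} [Field F] [Field L] [Algebra F L]
    {l : L} (hl : Transcendental F l) :
    ∃ A : ValuationSubring L, (∀ c : F, algebraMap F L c ∈ A) ∧ A.valuation l < 1 ∧
      ∀ x : L, ∃ m : ℕ, A.valuation l ^ m * A.valuation x ≤ 1 := by
  obtain ⟨k, hk, halg⟩ := exists_intermediateField_transcendental hl
  have haeval : ∀ c ∈ Algebra.adjoin k {l}, ∃ q : k[X], aeval l q = c := fun c hc => by
    rw [Algebra.adjoin_singleton_eq_range_aeval] at hc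
    exact hc
  set R : Subring L := (Algebra.adjoin k {l}).toSubring with hR
  have hlR : l ∈ R := Algebra.subset_adjoin rfl
  set I : Ideal R := Ideal.span {⟨l, hlR⟩} with hI
  have hI1 : I ≠ ⊤ := by
    rw [Ne, Ideal.eq_top_iff_one, hI, Ideal.mem_span_singleton]
    rintro ⟨⟨c, hc⟩, hlc⟩
    obtain ⟨q, rfl⟩ := haeval c hc
    have h1 : aeval l (X * q - 1) = 0 := by
      have := congrArg Subtype.val hlc
      simp only [Subring.coe_one, Subring.coe_mul] at this
      simp [← this]
    have h2 := (transcendental_iff.1 hk) _ h1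
    have := congrArg (eval 0) h2
    simp at this
  -- Since `l` generates a proper ideal of `k[l]`, a valuation ring containing `k[l]` has `l` among
  -- its nonunits.
  obtain ⟨A, hRA, hIA⟩ := Ideal.image_subset_nonunits_valuationSubring I hI1

  set v := A.valuation with hv
  have hRv : ∀ c ∈ Algebra.adjoin k {l}, v c ≤ 1 := fun c hc =>
    (A.valuation_le_one_iff c).2 (hRA hc)
  have hkv : ∀ c : k, c ≠ 0 → v (c : L) = 1 := fun c hc => by
    have h1 : ∀ c : k, v (c : L) ≤ 1 := fun c =>
      hRv _ (Subalgebra.algebraMap_mem (Algebra.adjoin k {l}) c)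
    refine le_antisymm (h1 c) ?_
    have h2 := h1 c⁻¹
    rw [IntermediateField.coe_inv, map_inv₀] at h2
    have h3 : v (c : L) ≠ 0 := (Valuation.ne_zero_iff _).2 (by simpa using hc)
    exact (inv_le_one₀ (zero_lt_iff.2 h3)).1 h2
  have hl1 : v l < 1 := A.mem_nonunits_iff.1
    (hIA ⟨⟨l, hlR⟩, Ideal.subset_span rfl, rfl⟩)
  -- A nonzero polynomial in `l` is a power of `l` times one with nonzero constant term, and the
  -- latter has value 1.
  have hlow : ∀ c ∈ Algebra.adjoin k {l}, c ≠ 0 → ∃ m : ℕ, v l ^ m ≤ v c := by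
    intro c hc hc0
    obtain ⟨q, rfl⟩ := haeval c hc
    have hq0 : q ≠ 0 := by rintro rfl; simp at hc0
    obtain ⟨q', hq', hq'0⟩ := exists_eq_pow_rootMultiplicity_mul_and_not_dvd q hq0 0
    rw [C_0, sub_zero] at hq' hq'0
    refine ⟨q.rootMultiplicity 0, ?_⟩
    rw [X_dvd_iff] at hq'0
    have h1 : v (aeval l q') = 1 := by
      rw [← divX_mul_X_add q', map_add, map_mul, aeval_X, aeval_C]
      have h2 : v (algebraMap k L (q'.coeff 0)) = 1 := hkv _ hq'0
      rw [v.map_add_eq_of_lt_right, h2]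
      rw [h2, map_mul]
      exact mul_lt_one_of_le_lt (hRv _ (aeval_mem_adjoin_singleton _ _)) hl1
    have h3 : aeval l q = l ^ q.rootMultiplicity 0 * aeval l q' := by
      conv_lhs => rw [hq']
      simp
    rw [h3, map_mul, h1, mul_one, map_pow]
  refine ⟨A, fun c => ?_, hl1, fun x => ?_⟩
  · exact hRA (Subalgebra.algebraMap_mem (Algebra.adjoin k {l}) (algebraMap F k c))
  · rcases le_or_gt (v x) 1 with hx | hx
    · exact ⟨0, by rw [pow_zero, one_mul]; exact hx⟩
    obtain ⟨p, hp0, hpc, hpx⟩ := halg x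
    obtain ⟨m, hm⟩ := hlow p.leadingCoeff (hpc _) (leadingCoeff_ne_zero.2 hp0)
    exact ⟨m, (mul_le_mul_left hm _).trans
      (val_root_bound v hp0 (fun i => hRv _ (hpc i)) hpx hx)⟩

end ExistsValuation

end RatDyn

namespace RatDyn

open Polynomial

/-! ### Values and derivatives in local coordinates -/

section Local

variable {L : Type*} [Field L]

/-- `f` is regular at `a` with value `b` and derivative `b'`. -/
def HasJet (f : RatFunc L) (a b b' : L) : Prop :=
  ∃ P Q : L[X], Q.eval a ≠ 0 ∧ f = algebraMap L[X] (RatFunc L) P / algebraMap L[X] (RatFunc L) Q ∧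
    b = P.eval a / Q.eval a ∧
    b' = (P.derivative.eval a * Q.eval a - P.eval a * Q.derivative.eval a) / Q.eval a ^ 2

lemma algebraMap_poly_ne_zero {Q : L[X]} (h : Q ≠ 0) : algebraMap L[X] (RatFunc L) Q ≠ 0 :=
  (RatFunc.algebraMap_ne_zero h)

lemma ne_zero_of_eval {Q : L[X]} {a : L} (h : Q.eval a ≠ 0) : Q ≠ 0 := by
  rintro rfl; simp at h

lemma HasJet.C (c a : L) : HasJet (RatFunc.C c) a c 0 :=
  ⟨Polynomial.C c, 1, by simp, by simp [RatFunc.algebraMap_C], by simp, by simp⟩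

lemma HasJet.X (a : L) : HasJet RatFunc.X a a 1 :=
  ⟨Polynomial.X, 1, by simp, by simp, by simp, by simp⟩

lemma HasJet.add {f g : RatFunc L} {a b b' c c' : L} (hf : HasJet f a b b')
    (hg : HasJet g a c c') : HasJet (f + g) a (b + c) (b' + c') := by
  obtain ⟨P, Q, hQ, rfl, rfl, rfl⟩ := hf
  obtain ⟨R, S, hS, rfl, rfl, rfl⟩ := hg
  refine ⟨P * S + Q * R, Q * S, by simp [hQ, hS], ?_, ?_, ?_⟩
  · have h1 := algebraMap_poly_ne_zero (ne_zero_of_eval hQ)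
    have h2 := algebraMap_poly_ne_zero (ne_zero_of_eval hS)
    rw [div_add_div _ _ h1 h2]; simp
  · simp only [eval_add, eval_mul]; field_simp
  · simp only [eval_add, eval_mul, derivative_add, derivative_mul]; field_simp; ring

lemma HasJet.mul {f g : RatFunc L} {a b b' c c' : L} (hf : HasJet f a b b')
    (hg : HasJet g a c c') : HasJet (f * g) a (b * c) (b' * c + b * c') := by
  obtain ⟨P, Q, hQ, rfl, rfl, rfl⟩ := hf
  obtain ⟨R, S, hS, rfl, rfl, rfl⟩ := hg
  refine ⟨P * R, Q * S, by simp [hQ, hS], ?_, ?_, ?_⟩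
  · rw [div_mul_div_comm]; simp
  · simp only [eval_mul]; field_simp
  · simp only [eval_mul, derivative_mul, eval_add]; field_simp; ring

lemma HasJet.inv {f : RatFunc L} {a b b' : L} (hf : HasJet f a b b') (hb : b ≠ 0) :
    HasJet f⁻¹ a b⁻¹ (-b' / b ^ 2) := by
  obtain ⟨P, Q, hQ, rfl, rfl, rfl⟩ := hf
  have hP : P.eval a ≠ 0 := fun h => hb (by rw [h, zero_div])
  refine ⟨Q, P, hP, by rw [inv_div], by rw [inv_div], ?_⟩
  field_simp; ring

lemma HasJet.div {f g : RatFunc L} {a b b' c c' : L} (hf : HasJet f a b b')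
    (hg : HasJet g a c c') (hc : c ≠ 0) :
    HasJet (f / g) a (b / c) ((b' * c - b * c') / c ^ 2) := by
  have := hf.mul (hg.inv hc)
  rw [div_eq_mul_inv f g, div_eq_mul_inv b c]
  convert this using 1
  field_simp
  ring

lemma HasJet.aeval {ψ : RatFunc L} {a b b' : L} (hψ : HasJet ψ a b b') (P : L[X]) :
    HasJet (Polynomial.aeval ψ P) a (P.eval b) (P.derivative.eval b * b') := by
  induction P using Polynomial.induction_on' with
  | add p q hp hq =>
    rw [map_add, eval_add, derivative_add, eval_add, add_mul]
    exact hp.add hq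
  | monomial n c =>
    rw [← C_mul_X_pow_eq_monomial]
    induction n with
    | zero =>
      simpa [RatFunc.algebraMap_eq_C] using HasJet.C c a
    | succ n ih =>
      rw [pow_succ, ← mul_assoc, map_mul, aeval_X, eval_mul, derivative_mul, derivative_X,
        mul_one, eval_add, eval_mul (q := Polynomial.X), eval_X]
      convert ih.mul hψ using 1
      ring

lemma HasJet.denom_ne_zero {f : RatFunc L} {a b b' : L} (h : HasJet f a b b') :
    f.denom.eval a ≠ 0 := by
  obtain ⟨P, Q, hQ, rfl, -, -⟩ := h
  intro h0
  obtain ⟨R, hR⟩ := RatFunc.denom_div_dvd P Q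
  rw [hR, eval_mul, h0, zero_mul] at hQ
  exact hQ rfl

/-- Independence of the representing fraction allows computations with fractions that are not in
lowest terms. -/
lemma HasJet.unique {f : RatFunc L} {a b b' c c' : L} (h1 : HasJet f a b b')
    (h2 : HasJet f a c c') : b = c ∧ b' = c' := by
  obtain ⟨P, Q, hQ, rfl, rfl, rfl⟩ := h1
  obtain ⟨R, S, hS, h, rfl, rfl⟩ := h2
  rw [div_eq_div_iff (algebraMap_poly_ne_zero (ne_zero_of_eval hQ))
    (algebraMap_poly_ne_zero (ne_zero_of_eval hS)), ← map_mul, ← map_mul] at h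
  have h' := RatFunc.algebraMap_injective L h
  have e1 := congrArg (eval a) h'
  have e2 := congrArg (fun p => eval a (derivative p)) h'
  simp only [eval_mul, derivative_mul, eval_add] at e1 e2
  refine ⟨by rw [div_eq_div_iff hQ hS, e1], ?_⟩
  have e3 : eval a R = eval a P * eval a S / eval a Q := by field_simp; rw [e1]
  have e4 : eval a (derivative R) = (eval a (derivative P) * eval a S
      + eval a P * eval a (derivative S) - eval a R * eval a (derivative Q)) / eval a Q := by
    field_simp; linear_combination -e2
  rw [e4, e3]
  field_simp
  ring

lemma hasJet_of_denom {f : RatFunc L} {a : L} (h : f.denom.eval a ≠ 0) :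
    HasJet f a (f.num.eval a / f.denom.eval a) (derivAt f a) :=
  ⟨f.num, f.denom, h, (RatFunc.num_div_denom f).symm, rfl, rfl⟩

lemma num_eval_ne_zero {f : RatFunc L} {a : L} (h : f.denom.eval a = 0) : f.num.eval a ≠ 0 := by
  intro h0
  obtain ⟨u, w, huw⟩ := RatFunc.isCoprime_num_denom f
  have := congrArg (eval a) huw
  simp [h, h0] at this

lemma hasJet_inv_of_denom {f : RatFunc L} {a : L} (h : f.denom.eval a = 0) :
    HasJet f⁻¹ a 0 (derivAt f⁻¹ a) := by
  have h1 := num_eval_ne_zero h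
  have h2 : HasJet f⁻¹ a 0 _ :=
    ⟨f.denom, f.num, h1, by rw [← inv_div, RatFunc.num_div_denom], by rw [h, zero_div], rfl⟩
  have h3 := hasJet_of_denom h2.denom_ne_zero
  obtain ⟨h4, -⟩ := h3.unique h2
  rwa [h4] at h3

open Classical in
/-- The value of `f` at the finite point `a`, as a point of the projective line. -/
noncomputable def valAt (f : RatFunc L) (a : L) : OnePoint L :=
  if f.denom.eval a = 0 then OnePoint.infty
  else OnePoint.some (f.num.eval a / f.denom.eval a)

open Classical in
/-- The derivative of `f` at the finite point `a`, in the coordinate at the target. -/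
noncomputable def slopeAt (f : RatFunc L) (a : L) : L :=
  if f.denom.eval a = 0 then derivAt f⁻¹ a else derivAt f a

lemma HasJet.valAt {f : RatFunc L} {a b b' : L} (h : HasJet f a b b') :
    valAt f a = OnePoint.some b := by
  rw [RatDyn.valAt, if_neg h.denom_ne_zero, ((hasJet_of_denom h.denom_ne_zero).unique h).1]

lemma HasJet.slopeAt {f : RatFunc L} {a b b' : L} (h : HasJet f a b b') : slopeAt f a = b' := by
  rw [RatDyn.slopeAt, if_neg h.denom_ne_zero, ((hasJet_of_denom h.denom_ne_zero).unique h).2]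

lemma HasJet.denom_of_inv {f : RatFunc L} (hf : f ≠ 0) {a b' : L} (h : HasJet f⁻¹ a 0 b') :
    f.denom.eval a = 0 := by
  by_contra h0
  have h1 := h.mul (hasJet_of_denom h0)
  rw [inv_mul_cancel₀ hf, zero_mul] at h1
  have h2 := HasJet.C (1 : L) a
  rw [map_one] at h2
  exact zero_ne_one (h1.unique h2).1

lemma HasJet.valAt_of_inv {f : RatFunc L} (hf : f ≠ 0) {a b' : L} (h : HasJet f⁻¹ a 0 b') :
    RatDyn.valAt f a = OnePoint.infty := by
  rw [RatDyn.valAt, if_pos (h.denom_of_inv hf)]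

lemma HasJet.slopeAt_of_inv {f : RatFunc L} (hf : f ≠ 0) {a b' : L} (h : HasJet f⁻¹ a 0 b') :
    RatDyn.slopeAt f a = b' := by
  rw [RatDyn.slopeAt, if_pos (h.denom_of_inv hf)]
  exact ((hasJet_inv_of_denom (h.denom_of_inv hf)).unique h).2

/-- At a pole the jet of `f⁻¹` is used: its value 0 is the coordinate of infinity. -/
lemma valAt_cases (f : RatFunc L) (a : L) :
    (∃ b, valAt f a = OnePoint.some b ∧ HasJet f a b (slopeAt f a)) ∨
      (valAt f a = OnePoint.infty ∧ f ≠ 0 ∧ HasJet f⁻¹ a 0 (slopeAt f a)) := by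
  by_cases h : f.denom.eval a = 0
  · right
    refine ⟨by rw [valAt, if_pos h], ?_, ?_⟩
    · rintro rfl; simp at h
    · rw [slopeAt, if_pos h]; exact hasJet_inv_of_denom h
  · left
    refine ⟨_, by rw [valAt, if_neg h], ?_⟩
    rw [slopeAt, if_neg h]; exact hasJet_of_denom h

lemma onP1_eq (φ : RatFunc L) (x : OnePoint L) : onP1 φ x = valAt (pull φ x) (coord x) := rfl

lemma localDeriv_eq (φ : RatFunc L) (x : OnePoint L) :
    localDeriv φ x = slopeAt (pull φ x) (coord x) := rfl

end Local

/-! ### Composition, iteration and the chain rule -/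

section Composition

variable {L : Type*} [Field L]

/-- Substitution of a transcendental `ψ` as a homomorphism of fields. -/
noncomputable def compHom (ψ : RatFunc L) (hψ : Transcendental L ψ) : RatFunc L →ₐ[L] RatFunc L :=
  RatFunc.liftAlgHom (aeval ψ) (nonZeroDivisors_le_comap_nonZeroDivisors_of_injective _
    (transcendental_iff_injective.1 hψ))

lemma compHom_div (ψ : RatFunc L) (hψ : Transcendental L ψ) (P Q : L[X]) :
    compHom ψ hψ (algebraMap L[X] (RatFunc L) P / algebraMap L[X] (RatFunc L) Q)
      = aeval ψ P / aeval ψ Q :=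
  RatFunc.liftAlgHom_apply_div _ _ _ _

lemma comp_eq (φ ψ : RatFunc L) (hψ : Transcendental L ψ) : comp φ ψ = compHom ψ hψ φ := by
  rw [← RatFunc.num_div_denom φ, compHom_div, RatFunc.num_div_denom]
  rfl

lemma compHom_X (ψ : RatFunc L) (hψ : Transcendental L ψ) : compHom ψ hψ RatFunc.X = ψ := by
  rw [← RatFunc.algebraMap_X, ← div_one (algebraMap L[X] (RatFunc L) X),
    ← map_one (algebraMap L[X] (RatFunc L)), compHom_div]
  simp

lemma ratFunc_algHom_ext {f g : RatFunc L →ₐ[L] RatFunc L} (h : f RatFunc.X = g RatFunc.X) :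
    f = g := by
  ext φ
  have key : ∀ P : L[X], f (algebraMap _ _ P) = g (algebraMap _ _ P) := fun P => by
    rw [← RatFunc.aeval_X_left_eq_algebraMap, ← aeval_algHom_apply, ← aeval_algHom_apply, h]
  rw [← RatFunc.num_div_denom φ, map_div₀, map_div₀, key, key]

lemma transcendental_comp {φ ψ : RatFunc L} (hφ : Transcendental L φ) (hψ : Transcendental L ψ) :
    Transcendental L (comp φ ψ) := by
  rw [comp_eq φ ψ hψ]
  exact fun h => hφ ((isAlgebraic_algHom_iff (compHom ψ hψ) (compHom ψ hψ).toRingHom.injective).1 h)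

lemma comp_assoc (φ : RatFunc L) {ψ χ : RatFunc L} (hψ : Transcendental L ψ)
    (hχ : Transcendental L χ) : comp (comp φ ψ) χ = comp φ (comp ψ χ) := by
  rw [comp_eq _ χ hχ, comp_eq _ ψ hψ, comp_eq φ _ (transcendental_comp hψ hχ)]
  have : (compHom χ hχ).comp (compHom ψ hψ) = compHom (comp ψ χ) (transcendental_comp hψ hχ) := by
    apply ratFunc_algHom_ext
    rw [AlgHom.comp_apply, compHom_X, compHom_X, comp_eq ψ χ hχ]
  rw [← this]; rfl

lemma transcendental_X_inv : Transcendental L (RatFunc.X : RatFunc L)⁻¹ := by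
  intro h
  have := h.inv
  rw [inv_inv] at this
  exact RatFunc.transcendental_X this

lemma transcendental_inv {ψ : RatFunc L} (h : Transcendental L ψ) : Transcendental L ψ⁻¹ := by
  intro h1
  have := h1.inv
  rw [inv_inv] at this
  exact h this

lemma transcendental_pull {ψ : RatFunc L} (h : Transcendental L ψ) (x : OnePoint L) :
    Transcendental L (pull ψ x) := by
  cases x with
  | infty => exact transcendental_comp h transcendental_X_inv
  | coe a => exact h

/-- It reduces the chain rule at a pole of `ψ` to the finite value 0 of `ψ⁻¹`, with `φ` read in the
coordinate at infinity. -/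
lemma comp_X_inv_comp_inv (φ : RatFunc L) {ψ : RatFunc L} (hψ : Transcendental L ψ) :
    comp (comp φ RatFunc.X⁻¹) ψ⁻¹ = comp φ ψ := by
  rw [comp_assoc φ transcendental_X_inv (transcendental_inv hψ),
    comp_eq _ _ (transcendental_inv hψ), map_inv₀, compHom_X, inv_inv]

lemma HasJet.comp {φ ψ : RatFunc L} (hψ : Transcendental L ψ) {a b b' c c' : L}
    (h : HasJet ψ a b b') (hφ : HasJet φ b c c') : HasJet (comp φ ψ) a c (c' * b') := by
  rw [comp_eq φ ψ hψ]
  obtain ⟨P, Q, hQ, rfl, rfl, rfl⟩ := hφ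
  rw [compHom_div]
  convert (h.aeval P).div (h.aeval Q) hQ using 1
  ring

lemma valAt_slopeAt_comp (φ : RatFunc L) {ψ : RatFunc L} (hψ : Transcendental L ψ) {a b b' : L}
    (h : HasJet ψ a b b') :
    valAt (comp φ ψ) a = valAt φ b ∧ slopeAt (comp φ ψ) a = slopeAt φ b * b' := by
  rcases valAt_cases φ b with ⟨c, hc, hjet⟩ | ⟨hc, h0, hjet⟩
  · have := h.comp hψ hjet
    exact ⟨by rw [this.valAt, hc], this.slopeAt⟩
  · have := h.comp hψ hjet
    have e : RatDyn.comp φ⁻¹ ψ = (RatDyn.comp φ ψ)⁻¹ := by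
      rw [comp_eq _ _ hψ, comp_eq _ _ hψ, map_inv₀]
    have h1 : RatDyn.comp φ ψ ≠ 0 := by
      rw [comp_eq _ _ hψ]; exact (_root_.map_ne_zero _).2 h0
    rw [e] at this
    exact ⟨by rw [this.valAt_of_inv h1, hc], this.slopeAt_of_inv h1⟩

/-- Functoriality of the action on the projective line, and the chain rule. -/
lemma onP1_localDeriv_comp (φ : RatFunc L) {ψ : RatFunc L} (hψ : Transcendental L ψ)
    (x : OnePoint L) :
    onP1 (comp φ ψ) x = onP1 φ (onP1 ψ x) ∧
      localDeriv (comp φ ψ) x = localDeriv φ (onP1 ψ x) * localDeriv ψ x := by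
  have hpull : pull (comp φ ψ) x = comp φ (pull ψ x) := by
    cases x with
    | infty => exact comp_assoc φ hψ transcendental_X_inv
    | coe a => rfl
  have hp := transcendental_pull hψ x
  rw [onP1_eq, localDeriv_eq, hpull]
  rcases valAt_cases (pull ψ x) (coord x) with ⟨b, hb, hjet⟩ | ⟨hb, h0, hjet⟩
  · rw [onP1_eq ψ x, hb, localDeriv_eq ψ x]
    exact valAt_slopeAt_comp φ hp hjet
  · rw [onP1_eq ψ x, hb, localDeriv_eq ψ x, ← comp_X_inv_comp_inv φ hp]
    exact valAt_slopeAt_comp _ (transcendental_inv hp) hjet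

lemma onP1_comp (φ : RatFunc L) {ψ : RatFunc L} (hψ : Transcendental L ψ) (x : OnePoint L) :
    onP1 (comp φ ψ) x = onP1 φ (onP1 ψ x) := (onP1_localDeriv_comp φ hψ x).1

lemma localDeriv_comp (φ : RatFunc L) {ψ : RatFunc L} (hψ : Transcendental L ψ) (x : OnePoint L) :
    localDeriv (comp φ ψ) x = localDeriv φ (onP1 ψ x) * localDeriv ψ x :=
  (onP1_localDeriv_comp φ hψ x).2

lemma onP1_localDeriv_X (x : OnePoint L) :
    onP1 (RatFunc.X : RatFunc L) x = x ∧ localDeriv (RatFunc.X : RatFunc L) x = 1 := by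
  cases x with
  | infty =>
    have h1 : pull (RatFunc.X : RatFunc L) OnePoint.infty = RatFunc.X⁻¹ := by
      change comp RatFunc.X RatFunc.X⁻¹ = _
      rw [comp_eq _ _ transcendental_X_inv, compHom_X]
    have h2 : HasJet ((RatFunc.X : RatFunc L)⁻¹)⁻¹ 0 0 1 := by
      rw [inv_inv]; exact HasJet.X 0
    have h3 : (RatFunc.X : RatFunc L)⁻¹ ≠ 0 := inv_ne_zero RatFunc.X_ne_zero
    rw [onP1_eq, localDeriv_eq, h1]
    exact ⟨h2.valAt_of_inv h3, h2.slopeAt_of_inv h3⟩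
  | coe a =>
    exact ⟨(HasJet.X a).valAt, (HasJet.X a).slopeAt⟩

lemma transcendental_iter {φ : RatFunc L} (hφ : Transcendental L φ) (n : ℕ) :
    Transcendental L (iter φ n) := by
  induction n with
  | zero => exact RatFunc.transcendental_X
  | succ n ih => exact transcendental_comp hφ ih

lemma onP1_iter {φ : RatFunc L} (hφ : Transcendental L φ) (n : ℕ) (x : OnePoint L) :
    onP1 (iter φ n) x = (onP1 φ)^[n] x := by
  induction n with
  | zero => exact (onP1_localDeriv_X x).1
  | succ n ih =>
    rw [Function.iterate_succ_apply', ← ih]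
    exact onP1_comp φ (transcendental_iter hφ n) x

lemma localDeriv_iter {φ : RatFunc L} (hφ : Transcendental L φ) (n : ℕ) (x : OnePoint L) :
    localDeriv (iter φ n) x = ∏ j ∈ Finset.range n, localDeriv φ ((onP1 φ)^[j] x) := by
  induction n with
  | zero => exact (onP1_localDeriv_X x).2
  | succ n ih =>
    rw [Finset.prod_range_succ, ← ih, ← onP1_iter hφ, mul_comm]
    exact localDeriv_comp φ (transcendental_iter hφ n) x

end Composition

end RatDyn

namespace RatDyn

open Polynomial

/-! ### Degrees under Möbius transformations -/

section Degree

variable {L : Type*} [Field L]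

lemma degree_le_of_eq_div {f : RatFunc L} {P Q : L[X]} {D : ℕ} (hQ : Q ≠ 0)
    (hf : f = algebraMap L[X] (RatFunc L) P / algebraMap L[X] (RatFunc L) Q)
    (hPD : P.natDegree ≤ D) (hQD : Q.natDegree ≤ D) : degree f ≤ D := by
  refine max_le ?_ ?_
  · by_cases hP : P = 0
    · rw [hf, hP, map_zero, zero_div]; simp
    · refine le_trans (natDegree_le_of_dvd ?_ hP) hPD
      exact (RatFunc.num_dvd hP).2 ⟨Q, hQ, hf⟩
  · exact (natDegree_le_of_dvd ((RatFunc.denom_dvd hQ).2 ⟨P, hf⟩) hQ).trans hQD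

lemma degree_eq_of_coprime {f : RatFunc L} {P Q : L[X]} (hQ : Q ≠ 0) (hPQ : IsCoprime P Q)
    (hf : f = algebraMap L[X] (RatFunc L) P / algebraMap L[X] (RatFunc L) Q) :
    degree f = max P.natDegree Q.natDegree := by
  refine le_antisymm (degree_le_of_eq_div hQ hf (le_max_left _ _) (le_max_right _ _)) ?_
  have h : f.num * Q = P * f.denom := (RatFunc.num_mul_eq_mul_denom_iff hQ).2 hf
  have h1 : P ∣ f.num := hPQ.dvd_of_dvd_mul_right ⟨f.denom, h⟩
  have h2 : Q ∣ f.denom := hPQ.symm.dvd_of_dvd_mul_left ⟨f.num, by rw [← h]; ring⟩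
  refine max_le_max ?_ (natDegree_le_of_dvd h2 (RatFunc.denom_ne_zero f))
  by_cases hn : f.num = 0
  · have : P = 0 := by
      rw [hn, zero_mul] at h
      exact (mul_eq_zero.1 h.symm).resolve_right (RatFunc.denom_ne_zero f)
    rw [this]; simp
  · exact natDegree_le_of_dvd h1 hn

/-- Over an algebraically closed field an algebraic element is a constant, which has degree 0. -/
lemma transcendental_of_degree [IsAlgClosed L] {f : RatFunc L} (hf : 0 < degree f) :
    Transcendental L f := by
  intro h
  have h1 := h.isIntegral
  obtain ⟨c, rfl⟩ := minpoly.mem_range_of_degree_eq_one L f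
    (IsAlgClosed.degree_eq_one_of_irreducible L (minpoly.irreducible h1))
  rw [RatFunc.algebraMap_eq_C] at hf
  simp [degree] at hf

lemma degree_inv_le (f : RatFunc L) : degree f⁻¹ ≤ degree f := by
  by_cases hf : f = 0
  · rw [hf, inv_zero]
  refine degree_le_of_eq_div (P := f.denom) (Q := f.num) (RatFunc.num_ne_zero hf) ?_
    (le_max_right _ _) (le_max_left _ _)
  rw [← inv_div, RatFunc.num_div_denom]

lemma degree_add_C_le (f : RatFunc L) (c : L) : degree (f + RatFunc.C c) ≤ degree f := by
  refine degree_le_of_eq_div (P := f.num + C c * f.denom) (Q := f.denom)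
    (RatFunc.denom_ne_zero f) ?_ ?_ (le_max_right _ _)
  · have h := algebraMap_poly_ne_zero (RatFunc.denom_ne_zero f)
    rw [map_add, map_mul, add_div, mul_div_cancel_right₀ _ h, RatFunc.num_div_denom,
      RatFunc.algebraMap_C]
  · exact (natDegree_add_le _ _).trans (max_le_max le_rfl (natDegree_C_mul_le _ _))

lemma aeval_X_inv (P : L[X]) {D : ℕ} (hP : P.natDegree ≤ D) :
    aeval (RatFunc.X : RatFunc L)⁻¹ P
      = algebraMap L[X] (RatFunc L) (reflect D P) / RatFunc.X ^ D := by
  let _ : Invertible (RatFunc.X : RatFunc L)⁻¹ :=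
    ⟨RatFunc.X, mul_inv_cancel₀ RatFunc.X_ne_zero, inv_mul_cancel₀ RatFunc.X_ne_zero⟩
  have := eval₂_reflect_mul_pow (algebraMap L (RatFunc L)) (RatFunc.X : RatFunc L)⁻¹ D P hP
  rw [aeval_def, ← this, inv_pow, div_eq_mul_inv, ← RatFunc.aeval_X_left_eq_algebraMap]
  rfl

lemma comp_X_inv (φ : RatFunc L) {D : ℕ} (hD : degree φ ≤ D) :
    comp φ RatFunc.X⁻¹ = algebraMap L[X] (RatFunc L) (reflect D φ.num) /
      algebraMap L[X] (RatFunc L) (reflect D φ.denom) := by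
  have h1 := (le_max_left _ _).trans hD
  have h2 := (le_max_right _ _).trans hD
  rw [comp_eq φ _ transcendental_X_inv]
  conv_lhs => rw [← RatFunc.num_div_denom φ]
  rw [compHom_div, aeval_X_inv _ h1, aeval_X_inv _ h2,
    div_div_div_cancel_right₀ (pow_ne_zero _ RatFunc.X_ne_zero)]

lemma natDegree_reflect_le' (P : L[X]) {D : ℕ} (hP : P.natDegree ≤ D) :
    (reflect D P).natDegree ≤ D :=
  natDegree_reflect_le.trans (max_le le_rfl hP)

lemma degree_comp_X_inv_le (φ : RatFunc L) : degree (comp φ RatFunc.X⁻¹) ≤ degree φ :=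
  degree_le_of_eq_div (by rw [Ne, reflect_eq_zero_iff]; exact RatFunc.denom_ne_zero φ)
    (comp_X_inv φ le_rfl) (natDegree_reflect_le' _ (le_max_left _ _))
    (natDegree_reflect_le' _ (le_max_right _ _))

lemma transcendental_X_add_C (a : L) : Transcendental L (RatFunc.X + RatFunc.C a : RatFunc L) := by
  intro h
  have := h.sub (isAlgebraic_algebraMap (A := RatFunc L) a)
  rw [RatFunc.algebraMap_eq_C, add_sub_cancel_right] at this
  exact RatFunc.transcendental_X this

lemma degree_comp_X_add_C_le (φ : RatFunc L) (a : L) :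
    degree (comp φ (RatFunc.X + RatFunc.C a)) ≤ degree φ := by
  have key : ∀ P : L[X], aeval (RatFunc.X + RatFunc.C a : RatFunc L) P
      = algebraMap L[X] (RatFunc L) (P.comp (X + C a)) := fun P => by
    rw [← RatFunc.aeval_X_left_eq_algebraMap, aeval_comp]
    simp
  have hdeg : ∀ P : L[X], (P.comp (X + C a)).natDegree = P.natDegree := fun P => by
    rw [natDegree_comp, natDegree_X_add_C, mul_one]
  refine degree_le_of_eq_div (P := φ.num.comp (X + C a)) (Q := φ.denom.comp (X + C a)) ?_ ?_
    ((hdeg _).le.trans (le_max_left _ _)) ((hdeg _).le.trans (le_max_right _ _))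
  · intro h
    have h1 := key φ.denom
    rw [h, map_zero] at h1
    exact RatFunc.denom_ne_zero φ ((transcendental_iff.1 (transcendental_X_add_C a)) _ h1)
  · rw [comp_eq φ _ (transcendental_X_add_C a)]
    conv_lhs => rw [← RatFunc.num_div_denom φ]
    rw [compHom_div, key, key]

end Degree

/-! ### Critical points and the Wronskian -/

section Critical

variable {L : Type*} [Field L]

lemma onP1_coe_of_denom {φ : RatFunc L} {a : L} (h : φ.denom.eval a = 0) :
    onP1 φ (a : OnePoint L) = OnePoint.infty := if_pos h

lemma onP1_coe {φ : RatFunc L} {a : L} (h : φ.denom.eval a ≠ 0) :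
    onP1 φ (a : OnePoint L) = ((φ.num.eval a / φ.denom.eval a : L) : OnePoint L) := if_neg h

lemma localDeriv_coe {φ : RatFunc L} {a : L} (h : φ.denom.eval a ≠ 0) :
    localDeriv φ (a : OnePoint L) = slope φ.num φ.denom a := by
  have h1 : localDeriv φ (a : OnePoint L) = derivAt φ a := if_neg h
  rw [h1]
  simp [derivAt, slope, wronsk]

/-- Exchanging numerator and denominator only changes the sign of the Wronskian, so it detects
critical poles as well. -/
lemma isCritical_coe_iff (φ : RatFunc L) (a : L) :
    IsCritical φ (a : OnePoint L) ↔ (wronsk φ.num φ.denom).eval a = 0 := by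
  unfold IsCritical
  by_cases h : φ.denom.eval a = 0
  · have h1 := num_eval_ne_zero h
    have h2 : HasJet φ⁻¹ a 0 _ :=
      ⟨φ.denom, φ.num, h1, by rw [← inv_div, RatFunc.num_div_denom], by rw [h, zero_div], rfl⟩
    have h3 : φ ≠ 0 := by rintro rfl; simp at h
    have h4 : localDeriv φ (a : OnePoint L) = _ := h2.slopeAt_of_inv h3
    rw [h4]
    simp [wronsk, h, h1]
  · rw [localDeriv_coe h, slope]
    simp [h]

lemma eval_zero_reflect (D : ℕ) (P : L[X]) : (reflect D P).eval 0 = P.coeff D := by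
  rw [← coeff_zero_eq_eval_zero, coeff_reflect, revAt_le (Nat.zero_le _), Nat.sub_zero]

lemma eval_zero_derivative_reflect (D : ℕ) (P : L[X]) :
    (reflect (D + 1) P).derivative.eval 0 = P.coeff D := by
  rw [← coeff_zero_eq_eval_zero, coeff_derivative, coeff_reflect, zero_add,
    revAt_le (Nat.le_add_left 1 D), Nat.add_sub_cancel]
  simp

lemma onP1_infty {φ : RatFunc L} (h : φ.num.natDegree ≤ φ.denom.natDegree) :
    onP1 φ OnePoint.infty =
      ((φ.num.coeff φ.denom.natDegree / φ.denom.leadingCoeff : L) : OnePoint L) := by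
  have hjet : HasJet (comp φ RatFunc.X⁻¹) 0 (φ.num.coeff φ.denom.natDegree / φ.denom.leadingCoeff)
      _ :=
    ⟨_, _, by rw [eval_zero_reflect]; simp [RatFunc.denom_ne_zero],
      comp_X_inv φ (D := φ.denom.natDegree) (max_le h le_rfl),
      by rw [eval_zero_reflect, eval_zero_reflect, coeff_natDegree], rfl⟩
  exact hjet.valAt

/-- In the coordinate `1/z` numerator and denominator are reflected, and `h` says that the Wronskian
of the reflections vanishes at 0. -/
lemma isCritical_infty {φ : RatFunc L} {D : ℕ} (hD : degree φ = D + 1)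
    (h : φ.num.coeff D * φ.denom.coeff (D + 1) = φ.num.coeff (D + 1) * φ.denom.coeff D) :
    IsCritical φ OnePoint.infty := by
  have hpull := comp_X_inv φ hD.le
  by_cases hq : φ.denom.coeff (D + 1) = 0
  · have hp : φ.num.coeff (D + 1) ≠ 0 := by
      intro hp
      have h0 : D + 1 ≤ max φ.num.natDegree φ.denom.natDegree := hD.ge
      have h1 : φ.num.natDegree ≤ D + 1 := (le_max_left _ _).trans hD.le
      have h2 : φ.denom.natDegree ≤ D + 1 := (le_max_right _ _).trans hD.le
      rcases le_max_iff.1 h0 with h3 | h3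
      · have h4 := le_antisymm h1 h3
        rw [← h4, coeff_natDegree, leadingCoeff_eq_zero] at hp
        rw [hp] at h4; simp at h4
      · have h4 := le_antisymm h2 h3
        rw [← h4, coeff_natDegree, leadingCoeff_eq_zero] at hq
        exact RatFunc.denom_ne_zero φ hq
    have hjet : HasJet (comp φ RatFunc.X⁻¹)⁻¹ 0 0 _ :=
      ⟨_, _, by rw [eval_zero_reflect]; exact hp, by rw [hpull, inv_div],
        by rw [eval_zero_reflect, hq, zero_div], rfl⟩
    have h0 : comp φ RatFunc.X⁻¹ ≠ 0 := by
      rw [hpull]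
      refine div_ne_zero (algebraMap_poly_ne_zero ?_) (algebraMap_poly_ne_zero ?_)
      · exact ne_zero_of_eval (a := 0) (by rw [eval_zero_reflect]; exact hp)
      · rw [Ne, reflect_eq_zero_iff]; exact RatFunc.denom_ne_zero φ
    have h4 : localDeriv φ OnePoint.infty = _ := hjet.slopeAt_of_inv h0
    rw [IsCritical, h4]
    simp only [eval_zero_reflect, eval_zero_derivative_reflect]
    rw [div_eq_zero_iff]; left
    linear_combination -h
  · have hjet : HasJet (comp φ RatFunc.X⁻¹) 0 _ _ :=
      ⟨_, _, by rw [eval_zero_reflect]; exact hq, hpull, rfl, rfl⟩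
    have h4 : localDeriv φ OnePoint.infty = _ := hjet.slopeAt
    rw [IsCritical, h4]
    simp only [eval_zero_reflect, eval_zero_derivative_reflect]
    rw [div_eq_zero_iff]; left
    linear_combination h

lemma coeff_mul_subleading {A B : L[X]} {e : ℕ} (hA : A.natDegree ≤ e + 1)
    (hB : B.natDegree ≤ e + 2) :
    (A * B).coeff (2 * e + 2)
      = A.coeff (e + 1) * B.coeff (e + 1) + A.coeff e * B.coeff (e + 2) := by
  rw [coeff_mul, ← Finset.sum_subset (s₁ := {(e + 1, e + 1), (e, e + 2)}),
    Finset.sum_pair (by simp)]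
  · intro x hx
    simp only [Finset.mem_insert, Finset.mem_singleton] at hx
    rw [Finset.HasAntidiagonal.mem_antidiagonal]
    rcases hx with rfl | rfl <;> dsimp only <;> omega
  · intro x hx hx'
    rw [Finset.HasAntidiagonal.mem_antidiagonal] at hx
    simp only [Finset.mem_insert, Finset.mem_singleton, Prod.ext_iff] at hx'
    rcases lt_or_ge (e + 1) x.1 with h | h
    · rw [coeff_eq_zero_of_natDegree_lt (hA.trans_lt h), zero_mul]
    · rw [coeff_eq_zero_of_natDegree_lt (p := B) (hB.trans_lt (by omega)), mul_zero]

/-- The weights `e + 2` and `e + 1` differ by one, so the formula holds without factors in every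
characteristic. -/
lemma coeff_wronsk {P Q : L[X]} {e : ℕ} (hP : P.natDegree ≤ e + 2) (hQ : Q.natDegree ≤ e + 2) :
    (wronsk P Q).coeff (2 * e + 2)
      = P.coeff (e + 2) * Q.coeff (e + 1) - P.coeff (e + 1) * Q.coeff (e + 2) := by
  have hP' : (derivative P).natDegree ≤ e + 1 := (natDegree_derivative_le P).trans (by omega)
  have hQ' : (derivative Q).natDegree ≤ e + 1 := (natDegree_derivative_le Q).trans (by omega)
  rw [wronsk, coeff_sub, coeff_mul_subleading hP' hQ, mul_comm P, coeff_mul_subleading hQ' hP]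
  simp only [coeff_derivative]
  push_cast
  ring

/-- A rational function of degree at least two has a critical point. -/
lemma exists_isCritical [IsAlgClosed L] {φ : RatFunc L} (hφ : 2 ≤ degree φ) :
    ∃ c : OnePoint L, IsCritical φ c := by
  obtain ⟨e, he⟩ := Nat.exists_eq_add_of_le' hφ
  by_contra! hcon
  have h1 : ∀ x, (wronsk φ.num φ.denom).eval x ≠ 0 := fun x hx =>
    hcon _ ((isCritical_coe_iff φ x).2 hx)
  -- A Wronskian without roots is constant; its coefficient of degree `2 * e + 2` then vanishes,
  -- which makes infinity critical.
  have h2 := natDegree_eq_zero_of_no_root h1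
  have h3 := coeff_wronsk ((le_max_left _ _).trans he.le) ((le_max_right _ _).trans he.le)
  rw [coeff_eq_zero_of_natDegree_lt (by omega)] at h3
  exact hcon _ (isCritical_infty he (by linear_combination h3))

end Critical

end RatDyn

namespace RatDyn

open Polynomial

/-! ### The case of a critical point at infinity -/

section Rigidity

variable {L : Type*} [Field L]

/-- The union of the orbits of the critical points. -/
def critOrbits (φ : RatFunc L) : Set (OnePoint L) :=
  ⋃ c ∈ {c | IsCritical φ c}, Set.range fun n : ℕ => (onP1 φ)^[n] c

lemma subset_critOrbits {φ : RatFunc L} {c : OnePoint L} (hc : IsCritical φ c) (n : ℕ) :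
    (onP1 φ)^[n] c ∈ critOrbits φ :=
  Set.mem_biUnion (show c ∈ {c | IsCritical φ c} from hc) ⟨n, rfl⟩

lemma onP1_mem_critOrbits {φ : RatFunc L} {x : OnePoint L} (hx : x ∈ critOrbits φ) :
    onP1 φ x ∈ critOrbits φ := by
  simp only [critOrbits, Set.mem_iUnion] at hx
  obtain ⟨c, hc, n, rfl⟩ := hx
  have := subset_critOrbits hc (n + 1)
  rwa [Function.iterate_succ_apply'] at this

lemma finite_critOrbits {φ : RatFunc L} (hφ : IsPCF φ) (hW : wronsk φ.num φ.denom ≠ 0) :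
    (critOrbits φ).Finite := by
  refine Set.Finite.biUnion ?_ fun c hc => hφ c hc
  refine Set.Finite.subset (s := insert OnePoint.infty
    ((fun a : L => (a : OnePoint L)) '' {a | (wronsk φ.num φ.denom).IsRoot a})) ?_ ?_
  · exact ((finite_setOfPred_isRoot hW).image _).insert _
  · intro c hc
    cases c with
    | infty => exact Set.mem_insert _ _
    | coe a => exact Set.mem_insert_of_mem _ ⟨a, (isCritical_coe_iff φ a).1 hc, rfl⟩

lemma localDeriv_orbit_ne_zero {φ : RatFunc L} (hφ : Transcendental L φ) {γ : OnePoint L}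
    (hγ : γ ∈ Function.periodicPts (onP1 φ)) (hl : multiplier φ γ ≠ 0) (j : ℕ) :
    localDeriv φ ((onP1 φ)^[j] γ) ≠ 0 := by
  have hn := Function.minimalPeriod_pos_of_mem_periodicPts hγ
  rw [multiplier, localDeriv_iter hφ, Finset.prod_ne_zero_iff] at hl
  rw [← Function.iterate_mod_minimalPeriod_eq]
  exact hl _ (Finset.mem_range.2 (Nat.mod_lt _ hn))

lemma isAlgebraic_multiplier_of_isCritical_infty {F : Type*} [Field F] [Algebra F L]
    [IsAlgClosed L] {φ : RatFunc L} (hd : 2 ≤ degree φ)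
    (hchar : ∀ m : ℤ, m ≠ 0 → |m| ≤ degree φ → (m : F) ≠ 0) (hPCF : IsPCF φ)
    (hinf : IsCritical φ OnePoint.infty) {γ : OnePoint L}
    (hγ : γ ∈ Function.periodicPts (onP1 φ)) : IsAlgebraic F (multiplier φ γ) := by
  have hφ : Transcendental L φ := transcendental_of_degree (by omega)
  by_cases hl : multiplier φ γ = 0
  · rw [hl]; exact isAlgebraic_zero
  by_contra htr
  obtain ⟨A, hFA, hl1, harch⟩ := exists_valuationSubring htr
  have hn := Function.minimalPeriod_pos_of_mem_periodicPts hγ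
  have hne := localDeriv_orbit_ne_zero hφ hγ hl
  -- The cycle has no critical point, so it avoids infinity.
  have hcoe : ∀ j, ∃ a : L, (onP1 φ)^[j] γ = (a : OnePoint L) := fun j => by
    rcases h : (onP1 φ)^[j] γ with _ | a
    · exact absurd (show localDeriv φ ((onP1 φ)^[j] γ) = 0 by rw [h]; exact hinf) (hne j)
    · exact ⟨a, rfl⟩
  choose g hg using hcoe
  have hden : ∀ i, φ.denom.eval (g i) ≠ 0 := fun i h => by
    have h1 := hg (i + 1)
    rw [Function.iterate_succ_apply', hg i, onP1_coe_of_denom h] at h1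
    exact OnePoint.infty_ne_coe _ h1
  have horb : ∀ i, φ.num.eval (g i) / φ.denom.eval (g i) = g (i + 1) := fun i => by
    have h1 := hg (i + 1)
    rw [Function.iterate_succ_apply', hg i, onP1_coe (hden i)] at h1
    exact OnePoint.coe_injective h1
  have hslope : ∀ i, localDeriv φ ((onP1 φ)^[i] γ) = slope φ.num φ.denom (g i) := fun i => by
    rw [hg i, localDeriv_coe (hden i)]
  have hW : ∀ i, (wronsk φ.num φ.denom).eval (g i) ≠ 0 := fun i h => by
    refine hne i ?_
    rw [hslope, slope, h, zero_div]
  have H : CycleData A.valuation (degree φ) φ.num φ.denom g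
      (Function.minimalPeriod (onP1 φ) γ) {x : L | (x : OnePoint L) ∈ critOrbits φ} :=
    -- Both `m` and its inverse come from the field `F`, which lies in the valuation ring.
    { unit := fun m hm hmd => by
        have h1 : (m : F) ≠ 0 := hchar m hm hmd
        have h2 : ∀ c : F, A.valuation (algebraMap F L c) ≤ 1 := fun c =>
          (A.valuation_le_one_iff _).2 (hFA c)
        have h3 : algebraMap F L m = (m : L) := map_intCast _ _
        have h4 := h2 (m : F)⁻¹
        rw [map_inv₀, map_inv₀, h3] at h4
        have h5 : A.valuation (m : L) ≠ 0 := by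
          rw [Valuation.ne_zero_iff, ← h3]
          exact (_root_.map_ne_zero _).2 h1
        exact le_antisymm (h3 ▸ h2 m) ((inv_le_one₀ (zero_lt_iff.2 h5)).1 h4)
      coprime := RatFunc.isCoprime_num_denom φ
      degP := le_max_left _ _
      degQ := le_max_right _ _
      denom := hden
      orbit := horb
      periodic := fun i => by
        apply OnePoint.coe_injective
        rw [← hg, ← hg, Function.iterate_add_minimalPeriod_eq]
      noncrit := hW
      finite := (finite_critOrbits hPCF (ne_zero_of_eval (hW 0))).preimage
        OnePoint.coe_injective.injOn
      crit := fun x hx => subset_critOrbits ((isCritical_coe_iff φ x).2 hx) 0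
      invariant := fun x hx hQx => by
        have := onP1_mem_critOrbits hx
        rwa [onP1_coe hQx] at this
      infty := fun h => by
        have := subset_critOrbits hinf 1
        rwa [Function.iterate_one, onP1_infty h] at this }
  refine H.false_of_attracting hn hd (l := multiplier φ γ) ?_ hl1 harch
  rw [multiplier, localDeriv_iter hφ]
  exact Finset.prod_congr rfl fun j _ => hslope j

end Rigidity

/-! ### Moving a critical point to infinity -/

section Conjugation

variable {L : Type*} [Field L]

/-- The Möbius transformation `a + 1 / z`. -/
noncomputable def mob (a : L) : RatFunc L := RatFunc.X⁻¹ + RatFunc.C a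

/-- The Möbius transformation `1 / (z - a)`, inverse to `a + 1 / z`. -/
noncomputable def mobInv (a : L) : RatFunc L := (RatFunc.X - RatFunc.C a)⁻¹

lemma transcendental_X_sub_C (a : L) : Transcendental L (RatFunc.X - RatFunc.C a : RatFunc L) := by
  rw [sub_eq_add_neg, ← map_neg]; exact transcendental_X_add_C (-a)

lemma transcendental_mobInv (a : L) : Transcendental L (mobInv a) :=
  transcendental_inv (transcendental_X_sub_C a)

lemma compHom_C (ψ : RatFunc L) (hψ : Transcendental L ψ) (a : L) :
    compHom ψ hψ (RatFunc.C a) = RatFunc.C a := by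
  rw [← RatFunc.algebraMap_eq_C, AlgHom.commutes]

lemma comp_mob (χ : RatFunc L) (hχ : Transcendental L χ) (a : L) :
    comp (mob a) χ = χ⁻¹ + RatFunc.C a := by
  rw [comp_eq _ _ hχ, mob, map_add, map_inv₀, compHom_X, compHom_C]

lemma comp_mobInv (χ : RatFunc L) (hχ : Transcendental L χ) (a : L) :
    comp (mobInv a) χ = (χ - RatFunc.C a)⁻¹ := by
  rw [comp_eq _ _ hχ, mobInv, map_inv₀, map_sub, compHom_X, compHom_C]

lemma comp_X_add_C (χ : RatFunc L) (hχ : Transcendental L χ) (a : L) :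
    comp (RatFunc.X + RatFunc.C a) χ = χ + RatFunc.C a := by
  rw [comp_eq _ _ hχ, map_add, compHom_X, compHom_C]

lemma mob_eq_comp (a : L) : mob a = comp (RatFunc.X + RatFunc.C a) RatFunc.X⁻¹ := by
  rw [comp_X_add_C _ transcendental_X_inv, mob]

lemma transcendental_mob (a : L) : Transcendental L (mob a) := by
  rw [mob_eq_comp]
  exact transcendental_comp (transcendental_X_add_C a) transcendental_X_inv

lemma mobInv_comp_mob (a : L) : comp (mobInv a) (mob a) = RatFunc.X := by
  rw [comp_mobInv _ (transcendental_mob a), mob, add_sub_cancel_right, inv_inv]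

lemma mob_comp_mobInv (a : L) : comp (mob a) (mobInv a) = RatFunc.X := by
  rw [comp_mob _ (transcendental_mobInv a), mobInv, inv_inv, sub_add_cancel]

lemma comp_X (φ : RatFunc L) : comp φ RatFunc.X = φ := by
  rw [comp_eq _ _ RatFunc.transcendental_X]
  have : compHom RatFunc.X RatFunc.transcendental_X = AlgHom.id L (RatFunc L) :=
    ratFunc_algHom_ext (compHom_X _ _)
  rw [this]; rfl

lemma X_comp (φ : RatFunc L) (hφ : Transcendental L φ) : comp RatFunc.X φ = φ := by
  rw [comp_eq _ _ hφ, compHom_X]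

lemma degree_comp_mob_le (φ : RatFunc L) (a : L) : degree (comp φ (mob a)) ≤ degree φ := by
  rw [mob_eq_comp, ← comp_assoc φ (transcendental_X_add_C a) transcendental_X_inv]
  exact (degree_comp_X_inv_le _).trans (degree_comp_X_add_C_le _ _)

lemma degree_comp_mobInv_le (φ : RatFunc L) (a : L) : degree (comp φ (mobInv a)) ≤ degree φ := by
  have h : mobInv a = comp RatFunc.X⁻¹ (RatFunc.X + RatFunc.C (-a)) := by
    rw [comp_eq _ _ (transcendental_X_add_C (-a)), map_inv₀, compHom_X, mobInv, map_neg,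
      sub_eq_add_neg]
  rw [h, ← comp_assoc φ transcendental_X_inv (transcendental_X_add_C (-a))]
  exact (degree_comp_X_add_C_le _ _).trans (degree_comp_X_inv_le _)

lemma degree_mob_comp_le (χ : RatFunc L) (hχ : Transcendental L χ) (a : L) :
    degree (comp (mob a) χ) ≤ degree χ := by
  rw [comp_mob _ hχ]
  exact (degree_add_C_le _ _).trans (degree_inv_le _)

lemma degree_mobInv_comp_le (χ : RatFunc L) (hχ : Transcendental L χ) (a : L) :
    degree (comp (mobInv a) χ) ≤ degree χ := by
  rw [comp_mobInv _ hχ, sub_eq_add_neg, ← map_neg]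
  exact (degree_inv_le _).trans (degree_add_C_le _ _)

/-- The conjugate of `φ` by `a + 1 / z`. -/
noncomputable def conj (φ : RatFunc L) (a : L) : RatFunc L := comp (mobInv a) (comp φ (mob a))

lemma transcendental_conj {φ : RatFunc L} (hφ : Transcendental L φ) (a : L) :
    Transcendental L (conj φ a) :=
  transcendental_comp (transcendental_mobInv a) (transcendental_comp hφ (transcendental_mob a))

/-- Composing with a Möbius map on either side does not raise the degree, and `φ` is recovered from
its conjugate by such compositions. -/
lemma degree_conj {φ : RatFunc L} (hφ : Transcendental L φ) (a : L) :
    degree (conj φ a) = degree φ := by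
  have hc := transcendental_comp hφ (transcendental_mob a)
  have ht := transcendental_conj hφ a
  refine le_antisymm ((degree_mobInv_comp_le _ hc a).trans (degree_comp_mob_le φ a)) ?_
  have h : φ = comp (mob a) (comp (conj φ a) (mobInv a)) := by
    rw [← comp_assoc _ ht (transcendental_mobInv a), conj,
      ← comp_assoc (mob a) (transcendental_mobInv a) hc, mob_comp_mobInv,
      X_comp _ hc, comp_assoc φ (transcendental_mob a) (transcendental_mobInv a), mob_comp_mobInv,
      comp_X]
  conv_lhs => rw [h]
  exact (degree_mob_comp_le _ (transcendental_comp ht (transcendental_mobInv a)) a).trans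
    (degree_comp_mobInv_le _ a)

lemma onP1_mobInv_mob (a : L) (x : OnePoint L) : onP1 (mobInv a) (onP1 (mob a) x) = x := by
  rw [← onP1_comp _ (transcendental_mob a), mobInv_comp_mob, (onP1_localDeriv_X x).1]

lemma onP1_mob_mobInv (a : L) (x : OnePoint L) : onP1 (mob a) (onP1 (mobInv a) x) = x := by
  rw [← onP1_comp _ (transcendental_mobInv a), mob_comp_mobInv, (onP1_localDeriv_X x).1]

lemma localDeriv_mobInv_mob (a : L) (x : OnePoint L) :
    localDeriv (mobInv a) (onP1 (mob a) x) * localDeriv (mob a) x = 1 := by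
  rw [← localDeriv_comp _ (transcendental_mob a), mobInv_comp_mob, (onP1_localDeriv_X x).2]

lemma onP1_mob_infty (a : L) : onP1 (mob a) OnePoint.infty = (a : OnePoint L) := by
  have h : comp (mob a) RatFunc.X⁻¹ = RatFunc.X + RatFunc.C a := by
    rw [comp_mob _ transcendental_X_inv, inv_inv]
  have h1 : HasJet (comp (mob a) RatFunc.X⁻¹) 0 (0 + a) (1 + 0) := by
    rw [h]; exact (HasJet.X 0).add (HasJet.C a 0)
  rw [zero_add] at h1
  exact h1.valAt

lemma onP1_conj {φ : RatFunc L} (hφ : Transcendental L φ) (a : L) (x : OnePoint L) :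
    onP1 (conj φ a) x = onP1 (mobInv a) (onP1 φ (onP1 (mob a) x)) := by
  rw [conj, onP1_comp _ (transcendental_comp hφ (transcendental_mob a)),
    onP1_comp _ (transcendental_mob a)]

lemma localDeriv_conj {φ : RatFunc L} (hφ : Transcendental L φ) (a : L) (x : OnePoint L) :
    localDeriv (conj φ a) x = localDeriv (mobInv a) (onP1 φ (onP1 (mob a) x)) *
      (localDeriv φ (onP1 (mob a) x) * localDeriv (mob a) x) := by
  rw [conj, localDeriv_comp _ (transcendental_comp hφ (transcendental_mob a)),
    localDeriv_comp _ (transcendental_mob a), onP1_comp _ (transcendental_mob a)]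

lemma iterate_conj {φ : RatFunc L} (hφ : Transcendental L φ) (a : L) (n : ℕ) (x : OnePoint L) :
    (onP1 (conj φ a))^[n] x = onP1 (mobInv a) ((onP1 φ)^[n] (onP1 (mob a) x)) := by
  induction n with
  | zero => exact (onP1_mobInv_mob a x).symm
  | succ n ih =>
    rw [Function.iterate_succ_apply', ih, onP1_conj hφ a, onP1_mob_mobInv,
      Function.iterate_succ_apply']

lemma isCritical_conj_iff {φ : RatFunc L} (hφ : Transcendental L φ) (a : L) (x : OnePoint L) :
    IsCritical (conj φ a) x ↔ IsCritical φ (onP1 (mob a) x) := by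
  have h1 : localDeriv (mob a) x ≠ 0 :=
    right_ne_zero_of_mul_eq_one (localDeriv_mobInv_mob a x)
  have h2 : localDeriv (mobInv a) (onP1 φ (onP1 (mob a) x)) ≠ 0 := by
    have := localDeriv_mobInv_mob a (onP1 (mobInv a) (onP1 φ (onP1 (mob a) x)))
    rw [onP1_mob_mobInv] at this
    exact left_ne_zero_of_mul_eq_one this
  rw [IsCritical, IsCritical, localDeriv_conj hφ]
  simp [h1, h2]

lemma isPCF_conj {φ : RatFunc L} (hφ : Transcendental L φ) (a : L) (h : IsPCF φ) :
    IsPCF (conj φ a) := by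
  intro x hx
  have := (h _ ((isCritical_conj_iff hφ a x).1 hx)).image (onP1 (mobInv a))
  rw [← Set.range_comp] at this
  convert this using 2
  ext n
  rw [iterate_conj hφ]
  rfl

lemma isPeriodicPt_conj_iff {φ : RatFunc L} (hφ : Transcendental L φ) (a : L)
    (γ : OnePoint L) (n : ℕ) :
    Function.IsPeriodicPt (onP1 (conj φ a)) n (onP1 (mobInv a) γ) ↔
      Function.IsPeriodicPt (onP1 φ) n γ := by
  rw [Function.IsPeriodicPt, Function.IsPeriodicPt, Function.IsFixedPt, Function.IsFixedPt,
    iterate_conj hφ, onP1_mob_mobInv]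
  refine ⟨fun h => ?_, fun h => by rw [h]⟩
  have := congrArg (onP1 (mob a)) h
  rwa [onP1_mob_mobInv, onP1_mob_mobInv] at this

lemma minimalPeriod_conj {φ : RatFunc L} (hφ : Transcendental L φ) (a : L) (γ : OnePoint L) :
    Function.minimalPeriod (onP1 (conj φ a)) (onP1 (mobInv a) γ)
      = Function.minimalPeriod (onP1 φ) γ :=
  Function.minimalPeriod_eq_minimalPeriod_iff.2 (isPeriodicPt_conj_iff hφ a γ)

/-- The derivatives of the coordinate change telescope along the orbit. At a full period the two
remaining factors agree and cancel. -/
lemma localDeriv_iter_conj {φ : RatFunc L} (hφ : Transcendental L φ) (a : L)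
    (γ : OnePoint L) (n : ℕ) :
    localDeriv (mobInv a) γ * localDeriv (iter (conj φ a) n) (onP1 (mobInv a) γ)
      = localDeriv (mobInv a) ((onP1 φ)^[n] γ) * localDeriv (iter φ n) γ := by
  rw [localDeriv_iter (transcendental_conj hφ a), localDeriv_iter hφ]
  induction n with
  | zero => simp
  | succ n ih =>
    rw [Finset.prod_range_succ, ← mul_assoc, ih, Finset.prod_range_succ, iterate_conj hφ,
      onP1_mob_mobInv, localDeriv_conj hφ, onP1_mob_mobInv, Function.iterate_succ_apply']
    have := localDeriv_mobInv_mob a (onP1 (mobInv a) ((onP1 φ)^[n] γ))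
    rw [onP1_mob_mobInv] at this
    linear_combination (∏ j ∈ Finset.range n, localDeriv φ ((onP1 φ)^[j] γ)) *
      localDeriv (mobInv a) (onP1 φ ((onP1 φ)^[n] γ)) * localDeriv φ ((onP1 φ)^[n] γ) * this

lemma multiplier_conj {φ : RatFunc L} (hφ : Transcendental L φ) (a : L) (γ : OnePoint L) :
    multiplier (conj φ a) (onP1 (mobInv a) γ) = multiplier φ γ := by
  rw [multiplier, multiplier, minimalPeriod_conj hφ]
  have h := localDeriv_iter_conj hφ a γ (Function.minimalPeriod (onP1 φ) γ)
  rw [Function.iterate_minimalPeriod] at h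
  have h1 := localDeriv_mobInv_mob a (onP1 (mobInv a) γ)
  rw [onP1_mob_mobInv] at h1
  exact mul_left_cancel₀ (left_ne_zero_of_mul_eq_one h1) h

end Conjugation

/-- The multipliers of a post-critically finite map of degree `d`, over an algebraically closed
field of characteristic zero or greater than `d`, are algebraic over every subfield. -/
theorem isAlgebraic_multiplier {F L : Type*} [Field F] [Field L] [Algebra F L] [IsAlgClosed L]
    {φ : RatFunc L} (hd : 2 ≤ degree φ)
    (hchar : ∀ m : ℤ, m ≠ 0 → |m| ≤ degree φ → (m : F) ≠ 0) (hPCF : IsPCF φ)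
    {γ : OnePoint L} (hγ : γ ∈ Function.periodicPts (onP1 φ)) :
    IsAlgebraic F (multiplier φ γ) := by
  have hφ : Transcendental L φ := transcendental_of_degree (by omega)
  obtain ⟨c, hc⟩ := exists_isCritical hd
  cases c with
  | infty => exact isAlgebraic_multiplier_of_isCritical_infty hd hchar hPCF hc hγ
  | coe a =>
    rw [← multiplier_conj hφ a]
    refine isAlgebraic_multiplier_of_isCritical_infty (by rwa [degree_conj hφ])
      (by rwa [degree_conj hφ]) (isPCF_conj hφ a hPCF) ?_ ?_
    · rw [isCritical_conj_iff hφ, onP1_mob_infty]; exact hc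
    · obtain ⟨n, hn, hper⟩ := hγ
      exact ⟨n, hn, (isPeriodicPt_conj_iff hφ a γ n).2 hper⟩

/-- Coprimality is preserved by field extension, so nothing cancels. -/
lemma degree_toClosure {K : Type*} [Field K] (φ : RatFunc K) :
    degree (toClosure φ) = degree φ := by
  set ι := algebraMap K (AlgebraicClosure K)
  have hcop : IsCoprime (φ.num.map ι) (φ.denom.map ι) := by
    simpa only [coe_mapRingHom] using (RatFunc.isCoprime_num_denom φ).map (mapRingHom ι)
  have hmap : toClosure φ = algebraMap _ _ (φ.num.map ι) / algebraMap _ _ (φ.denom.map ι) := by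
    rw [toClosure, RatFunc.map_apply, coe_mapRingHom]
  have h := degree_eq_of_coprime
    (by rw [Ne, Polynomial.map_eq_zero]; exact RatFunc.denom_ne_zero φ) hcop hmap
  rw [h, natDegree_map, natDegree_map, degree]

end RatDyn

theorem corollary1p6 {K : Type*} [Field K] (hK : RatDyn.IsFunctionField K)
    (p : ℕ) [CharP K p] (d : ℕ) (hd : 2 ≤ d) (hp : p = 0 ∨ d < p)
    (φ : RatFunc K) (hφ : RatDyn.degree φ = d)
    (hPCF : RatDyn.IsPCF (RatDyn.toClosure φ))
    (γ : OnePoint (AlgebraicClosure K))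
    (hγ : γ ∈ Function.periodicPts (RatDyn.onP1 (RatDyn.toClosure φ))) :
    IsAlgebraic (⊥ : Subfield K) (RatDyn.multiplier (RatDyn.toClosure φ) γ) := by
  have hdeg := RatDyn.degree_toClosure φ
  refine RatDyn.isAlgebraic_multiplier (by omega) (fun m hm hmd h0 => ?_) hPCF hγ
  have h1 : (m : K) = 0 := by
    have := congrArg (Subtype.val : (⊥ : Subfield K) → K) h0
    simpa using this
  -- A nonzero multiple of a positive `p` has absolute value at least `p`, which is more than `d`.
  have h2 : (p : ℤ) ∣ m := (CharP.intCast_eq_zero_iff K p m).1 h1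
  have h3 := Int.le_of_dvd (abs_pos.2 hm) ((dvd_abs _ _).2 h2)
  rcases hp with rfl | hp
  · exact hm (by simpa using h2)
  · omega
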